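/- Let $M\ge 1$, let $p_0,\dots,p_M:\mathbb R\to\mathbb C$ be $C^\infty$ functions (for instance polynomials), let $\lambda\in\mathbb C$, and put $$P(\lambda;x,\tfrac{d}{dx})=\sum_{m=0}^M p_m(x)\bigl(\tfrac{d}{dx}\bigr)^m-\lambda .$$ Let $\upsilon:\mathbb R\to\mathbb R$ be a weight and let $H^\Diamond=L^2(\mathbb R,\upsilon(x)\,dx)$, with inner product $\langle f,g\rangle_{H^\Diamond}=\int f\,\overline g\,\upsilon\,dx$. Let $H$ be a complex Hilbert space of functions on $\mathbb R$ (modulo equality almost everywhere), with its own inner product, that is contained in $H^\Diamond$ as a set; that $H$ is a Hilbert space of functions means that if $u_k\to u$ in the norm of $H$ and $u_k(x)\to g(x)$ for almost every $x$, then $u=g$ almost everywhere. Let $(e_n)_{n\ge 0}$ and $(e_n^\Diamond)_{n\ge0}$ be complete orthonormal systems of $H$ and of $H^\Diamond$. Let $\widetilde B$ be the operator $f\mapsto P(\lambda;x,\frac{d}{dx})f$ from $H$ to $H^\Diamond$ with domain $\{f\in C^M(\mathbb R)\cap H: P(\lambda;x,\frac{d}{dx})f\in H^\Diamond\}$, and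 let $B$ be its closure. Assume the following. - (C1) Every $e_n$ belongs to the domain of $\widetilde B$ (so that $e_n\in C^M(\mathbb R)$). - (C2) With $b_m^n:=\langle Be_n,e_m^\Diamond\rangle_{H^\Diamond}$ there is an integer $\ell_0$ such that $b_m^n=0$ whenever $|n-m|>\ell_0$. - (C2$^+$) The weight $\upsilon$ is positive everywhere and of class $C^M$. - (C2.1) $\sup_{m\ge 0,\;n\ge1}|b_m^n|/n^M<\infty$. - (C2.2) Every $e_n^\Diamond$ is in $C^M(\mathbb R)$, and there are functions $n_1,n_0\in C^{M-1}(\mathbb R)$ (complex-valued) and real numbers $\lambda_n$ such that $n_1(e_n^\Diamond)'+n_0e_n^\Diamond=\lambda_ne_n^\Diamond$ for all $n\ge0$ and $\liminf_{n\to\infty}|\lambda_n|/n>0$ (the value $+\infty$ is allowed). - (C2.3) There is a continuous function $\tilde a:\mathbb R\to\mathbb R$ with $|e_n^\Diamond(x)|\le\tilde a(x)$ for all $n\ge0$ and $x\in\mathbb R$. Then for every square-summable complex sequence $(f_n)_{n\ge0}$ with $\sum_{n=0}^\infty b_m^nf_n=0$ for all $m\ge0$ there is a function $\varphi\in C^M(\mathbb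 R\setminus p_M^{-1}(0))$ such that, for every $x\in\mathbb R\setminus p_M^{-1}(0)$, $$P(\lambda;x,\tfrac{d}{dx})\varphi(x)=0\qquad\text{and}\qquad\lim_{N\to\infty}\sum_{n=0}^N f_ne_n(x)=\varphi(x).$$ -/

import Mathlib

open MeasureTheory Filter Topology
open scoped ContDiff

namespace BandODE

noncomputable section

/-- The action `∑_{m ≤ M} p_m(x) (d/dx)^m` of an ordinary differential operator of order `M`
with coefficient functions `p_m`. -/
def diffOp (M : ℕ) (p : ℕ → ℝ → ℂ) (φ : ℝ → ℂ) (x : ℝ) : ℂ :=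
  ∑ m ∈ Finset.range (M + 1), p m x * iteratedDeriv m φ x

/-- The action of `P(lam; x, d/dx) = P(x, d/dx) - lam I`. -/
def shiftedOp (M : ℕ) (p : ℕ → ℝ → ℂ) (lam : ℂ) (φ : ℝ → ℂ) (x : ℝ) : ℂ :=
  diffOp M p φ x - lam * φ x

theorem diffOp_add {M : ℕ} {p : ℕ → ℝ → ℂ} {φ ψ : ℝ → ℂ}
    (hφ : ContDiff ℝ M φ) (hψ : ContDiff ℝ M ψ) (x : ℝ) :
    diffOp M p (φ + ψ) x = diffOp M p φ x + diffOp M p ψ x := by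
  unfold diffOp
  rw [← Finset.sum_add_distrib]
  refine Finset.sum_congr rfl fun m hm => ?_
  have hmM : ((m : ℕ) : WithTop ℕ∞) ≤ (M : ℕ) := by
    exact_mod_cast Nat.lt_succ_iff.mp (Finset.mem_range.mp hm)
  rw [iteratedDeriv_add ((hφ.of_le hmM).contDiffAt) ((hψ.of_le hmM).contDiffAt), mul_add]

theorem diffOp_smul {M : ℕ} {p : ℕ → ℝ → ℂ} (c : ℂ) (φ : ℝ → ℂ) (x : ℝ) :
    diffOp M p (c • φ) x = c * diffOp M p φ x := by
  unfold diffOp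
  rw [Finset.mul_sum]
  refine Finset.sum_congr rfl fun m _ => ?_
  rw [iteratedDeriv_const_smul_field, smul_eq_mul]
  ring

theorem diffOp_zero (M : ℕ) (p : ℕ → ℝ → ℂ) (x : ℝ) :
    diffOp M p 0 x = 0 := by
  have h := diffOp_smul (M := M) (p := p) 0 0 x
  simpa using h

/-- The measure `υ(x) dx` on the real line. -/
def weightMeasure (υ : ℝ → ℝ) : Measure ℝ :=
  volume.withDensity fun x => ENNReal.ofReal (υ x)

/-- The space `L²(ℝ, υ(x) dx)` of complex functions, with inner product
`⟨f, g⟩ = ∫ f(x) conj(g(x)) υ(x) dx`. In Mathlib's convention `⟨f, g⟩` is `inner ℂ g f`. -/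
abbrev WeightedL2 (υ : ℝ → ℝ) : Type :=
  Lp ℂ 2 (weightMeasure υ)

/-- A Hilbert space `H` of functions on the real line (functions equal almost everywhere being
identified) which is contained, as a set, in `L²(ℝ, υ(x) dx)`. The inner product of `H` need not
be related to the one of `L²(ℝ, υ(x) dx)`; that `H` is a Hilbert space *of functions* means that
a limit in the norm of `H` and a pointwise almost everywhere limit of the same sequence agree. -/
structure FunctionSpaceIn (H : Type*) [NormedAddCommGroup H] [InnerProductSpace ℂ H]
    (υ : ℝ → ℝ) where
  /-- the function (class) that an element of `H` is -/
  toFn : H →ₗ[ℂ] WeightedL2 υ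
  injective : Function.Injective toFn
  limit_unique : ∀ (u : ℕ → H) (u₀ : H) (g : ℝ → ℂ), Tendsto u atTop (𝓝 u₀) →
    (∀ᵐ x ∂(weightMeasure υ), Tendsto (fun k => (toFn (u k) : ℝ → ℂ) x) atTop (𝓝 (g x))) →
    (toFn u₀ : ℝ → ℂ) =ᵐ[weightMeasure υ] g

/-- A quintuplet `(P(lam; x, d/dx), H, (e_n), H◇, (e◇_n))`, where `H◇ = L²(ℝ, υ(x) dx)`. -/
structure Quintuplet (H : Type*) [NormedAddCommGroup H] [InnerProductSpace ℂ H] where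
  /-- the order of `P(x, d/dx)` -/
  M : ℕ
  /-- the coefficient functions `p_0, …, p_M` (the others play no role) -/
  p : ℕ → ℝ → ℂ
  /-- the spectral parameter -/
  lam : ℂ
  /-- the weight of `H◇` -/
  υ : ℝ → ℝ
  /-- `H` as a space of functions contained in `H◇` -/
  space : FunctionSpaceIn H υ
  /-- the orthonormal basis of `H`, as vectors and as functions -/
  basis : HilbertBasis ℕ ℂ H
  e : ℕ → ℝ → ℂ
  basis_eq : ∀ n, (space.toFn (basis n) : ℝ → ℂ) =ᵐ[weightMeasure υ] e n
  /-- the orthonormal basis of `H◇`, as vectors and as functions -/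
  basisD : HilbertBasis ℕ ℂ (WeightedL2 υ)
  eD : ℕ → ℝ → ℂ
  basisD_eq : ∀ n, (basisD n : ℝ → ℂ) =ᵐ[weightMeasure υ] eD n

namespace Quintuplet

variable {H : Type*} [NormedAddCommGroup H] [InnerProductSpace ℂ H] (Q : Quintuplet H)

/-- The graph of `B̃`: the pairs `(f, P(lam; x, d/dx) f)` with `f ∈ C^M(ℝ) ∩ H` and
`P(lam; x, d/dx) f ∈ H◇`. -/
def graphBt : Submodule ℂ (H × WeightedL2 Q.υ) where
  carrier := {q | ∃ φ : ℝ → ℂ, ContDiff ℝ Q.M φ ∧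
    (Q.space.toFn q.1 : ℝ → ℂ) =ᵐ[weightMeasure Q.υ] φ ∧
    (q.2 : ℝ → ℂ) =ᵐ[weightMeasure Q.υ] shiftedOp Q.M Q.p Q.lam φ}
  add_mem' := by
    rintro a b ⟨φ, hφ, ha1, ha2⟩ ⟨ψ, hψ, hb1, hb2⟩
    refine ⟨φ + ψ, hφ.add hψ, ?_, ?_⟩
    · rw [Prod.fst_add, map_add]
      exact (Lp.coeFn_add _ _).trans (ha1.add hb1)
    · rw [Prod.snd_add]
      refine (Lp.coeFn_add _ _).trans ((ha2.add hb2).trans (ae_of_all _ fun x => ?_))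
      simp only [shiftedOp, diffOp_add hφ hψ, Pi.add_apply]
      ring
  zero_mem' := by
    refine ⟨0, contDiff_const, ?_, ?_⟩
    · rw [Prod.fst_zero, map_zero]
      exact Lp.coeFn_zero _ _ _
    · rw [Prod.snd_zero]
      refine (Lp.coeFn_zero _ _ _).trans (ae_of_all _ fun x => ?_)
      simp [shiftedOp, diffOp_zero]
  smul_mem' := by
    rintro c a ⟨φ, hφ, ha1, ha2⟩
    refine ⟨c • φ, hφ.const_smul c, ?_, ?_⟩
    · rw [Prod.smul_fst, map_smul]
      exact (Lp.coeFn_smul _ _).trans (ha1.const_smul c)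
    · rw [Prod.smul_snd]
      refine (Lp.coeFn_smul _ _).trans ((ha2.const_smul c).trans (ae_of_all _ fun x => ?_))
      simp only [shiftedOp, diffOp_smul, Pi.smul_apply, smul_eq_mul]
      ring

/-- The operator `B̃ : f ↦ P(lam; x, d/dx) f` from `H` to `H◇`, with domain
`{f ∈ C^M(ℝ) ∩ H | P(lam; x, d/dx) f ∈ H◇}`. -/
def Bt : H →ₗ.[ℂ] WeightedL2 Q.υ :=
  Q.graphBt.toLinearPMap

/-- The operator `B`, the closure of `B̃`. -/
def B : H →ₗ.[ℂ] WeightedL2 Q.υ :=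
  Q.Bt.closure

/-- C1: every `e_n` belongs to the domain of `B̃` (and `e_n` is its continuous representative). -/
def C1 : Prop :=
  ∀ n, ContDiff ℝ Q.M (Q.e n) ∧ Q.basis n ∈ Q.Bt.domain

variable {Q} in
theorem C1.mem_domain (h : Q.C1) (n : ℕ) : Q.basis n ∈ Q.B.domain :=
  Q.Bt.le_closure.1 (h n).2

/-- The matrix elements `b_m^n = ⟨B e_n, e◇_m⟩` (linear in the first argument). -/
def b (h : Q.C1) (m n : ℕ) : ℂ :=
  inner ℂ (Q.basisD m) (Q.B ⟨Q.basis n, h.mem_domain n⟩)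

/-- C2: the matrix is band-diagonal. -/
def C2 (h : Q.C1) : Prop :=
  ∃ ℓ₀ : ℤ, ∀ m n : ℕ, ℓ₀ < |(n : ℤ) - (m : ℤ)| → Q.b h m n = 0

/-- C2⁺: the inner product of `H◇` is the one with a positive weight of class `C^M`. -/
def C2Plus : Prop :=
  (∀ x, 0 < Q.υ x) ∧ ContDiff ℝ Q.M Q.υ

/-- C2.1: `|b_m^n| / n^M` is bounded, uniformly in `m ≥ 0` and `n ≥ 1`. -/
def C2_1 (h : Q.C1) : Prop :=
  ∃ K : ℝ, ∀ m n : ℕ, 1 ≤ n → ‖Q.b h m n‖ / (n : ℝ) ^ Q.M ≤ K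

/-- C2.2: the `e◇_n` are of class `C^M` and are eigenfunctions of a first-order operator
`n₁ d/dx + n₀` with coefficients of class `C^(M-1)`, with real eigenvalues `lam_n` such that
`liminf |lam_n| / n > 0` (the lower limit is taken in the extended reals). -/
def C2_2 : Prop :=
  (∀ n, ContDiff ℝ Q.M (Q.eD n)) ∧
  ∃ n₁ n₀ : ℝ → ℂ, ContDiff ℝ (Q.M - 1 : ℕ) n₁ ∧ ContDiff ℝ (Q.M - 1 : ℕ) n₀ ∧
    ∃ lamN : ℕ → ℝ,
      (∀ n x, n₁ x * deriv (Q.eD n) x + n₀ x * Q.eD n x = (lamN n : ℂ) * Q.eD n x) ∧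
      (0 : EReal) < liminf (fun n : ℕ => ((|lamN n| / (n : ℝ) : ℝ) : EReal)) atTop

/-- C2.3: the `e◇_n` have a common continuous pointwise bound. -/
def C2_3 : Prop :=
  ∃ a : ℝ → ℝ, Continuous a ∧ ∀ n x, ‖Q.eD n x‖ ≤ a x

/-- The space `V` of the sequences `f` with `∑_n b_m^n f_n = 0` for all `m`. -/
def V (h : Q.C1) : Set (ℕ → ℂ) :=
  {f | ∀ m, HasSum (fun n => Q.b h m n * f n) 0}

end Quintuplet

end

end BandODE

/-! Square-summability of `f` only makes the partial sums `u_N = ∑_{n ≤ N} f_n e_n` converge in `H`,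
hence in `L²(υ dx)`. Pointwise convergence has to come from the equation, although `P u_N` need not
tend to zero.

By the band structure and `∑_n b_m^n f_n = 0`, `P u_N` is a combination of the `e◇_m` with `|m - N|
≤ L` only, with coefficients `o(N^M)`. These `e◇_m` oscillate at frequency of order at least `m`, so
each integration gains a factor `1/N`: the `M`-fold primitive of `P u_N` is `o(1)`, locally
uniformly, up to polynomials of degree less than `M` (`exists_residual_bound`).

In divergence form `P u = ∑_j (q_j u)^{(j)}` with `q_M = p_M`. Integrated `M` times it becomes `p_M
u` plus terms with at least one primitive, modulo polynomials. Those terms are controlled by `L²`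
convergence; the polynomials are controlled by integrating once more. So `u_N` converges uniformly
near any point with `p_M ≠ 0`, and the limit solves the integrated equation. Division by `p_M` then
raises its regularity up to `C^M`, and `M` derivatives return the differential equation.

The oscillation is a rigidity statement (`EigenSystem.exists_phase`). Where `n₁ ≠ 0`, `e◇_n' = (λ_n
- n₀) n₁⁻¹ e◇_n`. A nonzero real part of `n₁⁻¹` would make the bounded `e◇_n` exponentially small on
a segment, against completeness. So `n₁⁻¹ = iθ'` with `θ` real, and `e◇_n / e◇_k` is a constant
times `exp(i(λ_n - λ_k)θ)`. In the variable `θ` the Parseval sums are translation invariant, which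
forces `|e◇_k|² υ n₁` to be locally constant and, by connectedness, a nonzero constant for a
suitable `k`. Thus `n₁` and `e◇_k` have no zeros, and `θ'` is a constant times `|e◇_k|² υ`, so `θ`
is of class `C^{M+1}`: enough for `M` integrations by parts. -/

namespace BandODE

noncomputable section

/-! ### Iterated primitives and polynomials -/

/-- The primitive of `g` that vanishes at `a`. -/
def prim (a : ℝ) (g : ℝ → ℂ) (x : ℝ) : ℂ := ∫ t in a..x, g t

theorem hasDerivAt_prim {g : ℝ → ℂ} (hg : Continuous g) (a x : ℝ) :
    HasDerivAt (prim a g) (g x) x :=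
  intervalIntegral.integral_hasDerivAt_right (hg.intervalIntegrable _ _)
    (hg.stronglyMeasurableAtFilter _ _) hg.continuousAt

theorem deriv_prim {g : ℝ → ℂ} (hg : Continuous g) (a : ℝ) : deriv (prim a g) = g :=
  funext fun x => (hasDerivAt_prim hg a x).deriv

theorem continuous_prim {g : ℝ → ℂ} (hg : Continuous g) (a : ℝ) : Continuous (prim a g) :=
  continuous_iff_continuousAt.2 fun x => (hasDerivAt_prim hg a x).continuousAt

theorem prim_add {f g : ℝ → ℂ} (hf : Continuous f) (hg : Continuous g) (a : ℝ) :
    prim a (f + g) = prim a f + prim a g := by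
  ext x
  exact intervalIntegral.integral_add (hf.intervalIntegrable _ _) (hg.intervalIntegrable _ _)

theorem prim_smul (c : ℂ) (g : ℝ → ℂ) (a : ℝ) : prim a (c • g) = c • prim a g := by
  ext x
  simp [prim]

theorem prim_deriv {g : ℝ → ℂ} (hg : ContDiff ℝ 1 g) (a x : ℝ) :
    prim a (deriv g) x = g x - g a :=
  intervalIntegral.integral_deriv_eq_sub (fun y _ => (hg.differentiable one_ne_zero) y)
    ((hg.continuous_deriv le_rfl).intervalIntegrable _ _)

theorem norm_prim_le {g : ℝ → ℂ} {a δ B : ℝ} (h : ∀ x, |x - a| ≤ δ → ‖g x‖ ≤ B)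
    {x : ℝ} (hx : |x - a| ≤ δ) : ‖prim a g x‖ ≤ δ * B := by
  have hB : 0 ≤ B := (norm_nonneg _).trans (h x hx)
  have h1 : ‖∫ t in a..x, g t‖ ≤ B * |x - a| := by
    refine intervalIntegral.norm_integral_le_of_norm_le_const fun t ht => h t ?_
    have := Set.abs_sub_left_of_mem_uIcc (Set.uIoc_subset_uIcc ht)
    exact this.trans hx
  calc ‖prim a g x‖ ≤ B * |x - a| := h1
    _ ≤ B * δ := by gcongr
    _ = δ * B := mul_comm _ _

theorem continuous_primIter {g : ℝ → ℂ} (hg : Continuous g) (a : ℝ) (k : ℕ) :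
    Continuous ((prim a)^[k] g) := by
  induction k with
  | zero => exact hg
  | succ k ih => rw [Function.iterate_succ_apply']; exact continuous_prim ih a

theorem primIter_add {f g : ℝ → ℂ} (hf : Continuous f) (hg : Continuous g) (a : ℝ) (k : ℕ) :
    (prim a)^[k] (f + g) = (prim a)^[k] f + (prim a)^[k] g := by
  induction k with
  | zero => rfl
  | succ k ih =>
    rw [Function.iterate_succ_apply', ih, prim_add (continuous_primIter hf a k)
      (continuous_primIter hg a k), Function.iterate_succ_apply', Function.iterate_succ_apply']

theorem primIter_smul (c : ℂ) (g : ℝ → ℂ) (a : ℝ) (k : ℕ) :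
    (prim a)^[k] (c • g) = c • (prim a)^[k] g := by
  induction k with
  | zero => rfl
  | succ k ih =>
    rw [Function.iterate_succ_apply', ih, prim_smul, Function.iterate_succ_apply']

theorem primIter_zero (a : ℝ) (k : ℕ) : (prim a)^[k] 0 = 0 := by
  simpa using primIter_smul 0 0 a k

theorem primIter_sub {f g : ℝ → ℂ} (hf : Continuous f) (hg : Continuous g) (a : ℝ) (k : ℕ) :
    (prim a)^[k] (f - g) = (prim a)^[k] f - (prim a)^[k] g := by
  have := primIter_add hf (hg.const_smul (-1 : ℂ)) a k
  rw [primIter_smul] at this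
  simpa [sub_eq_add_neg] using this

theorem primIter_sum {ι : Type*} (s : Finset ι) (g : ι → ℝ → ℂ) (hg : ∀ i ∈ s, Continuous (g i))
    (a : ℝ) (k : ℕ) : (prim a)^[k] (∑ i ∈ s, g i) = ∑ i ∈ s, (prim a)^[k] (g i) := by
  classical
  induction s using Finset.induction_on with
  | empty => simpa using primIter_zero a k
  | insert i s hi ih =>
    rw [Finset.sum_insert hi, Finset.sum_insert hi, primIter_add (hg i (by simp)),
      ih fun j hj => hg j (by simp [hj])]
    have : Continuous fun x => ∑ i ∈ s, g i x :=
      continuous_finsetSum _ fun j hj => hg j (by simp [hj])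
    convert this using 1
    ext x; simp

theorem norm_primIter_le {g : ℝ → ℂ} {a δ B : ℝ} (h : ∀ x, |x - a| ≤ δ → ‖g x‖ ≤ B) (k : ℕ)
    {x : ℝ} (hx : |x - a| ≤ δ) : ‖(prim a)^[k] g x‖ ≤ δ ^ k * B := by
  induction k generalizing x with
  | zero => simpa using h x hx
  | succ k ih =>
    rw [Function.iterate_succ_apply', pow_succ', mul_assoc]
    exact norm_prim_le (fun y hy => ih hy) hx

/-- A polynomial function of degree less than `k` in `x - a`. -/
def polyFn (a : ℝ) (k : ℕ) (v : ℕ → ℂ) (x : ℝ) : ℂ :=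
  ∑ j ∈ Finset.range k, v j * ((x - a : ℝ) : ℂ) ^ j

theorem contDiff_polyFn (a : ℝ) (k : ℕ) (v : ℕ → ℂ) {n : WithTop ℕ∞} :
    ContDiff ℝ n (polyFn a k v) := by
  unfold polyFn
  refine ContDiff.sum fun j _ => contDiff_const.mul (ContDiff.pow ?_ j)
  exact Complex.ofRealCLM.contDiff.comp (contDiff_id.sub contDiff_const)

/-- Being a polynomial function of degree less than `k`. -/
def IsPolyLT (a : ℝ) (k : ℕ) (g : ℝ → ℂ) : Prop := ∃ v, g = polyFn a k v

theorem IsPolyLT.continuous {a : ℝ} {k : ℕ} {g : ℝ → ℂ} (h : IsPolyLT a k g) : Continuous g := by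
  obtain ⟨v, rfl⟩ := h
  exact (contDiff_polyFn a k v (n := 0)).continuous

theorem IsPolyLT.zero (a : ℝ) (k : ℕ) : IsPolyLT a k 0 :=
  ⟨0, by ext x; simp [polyFn]⟩

theorem IsPolyLT.add {a : ℝ} {k : ℕ} {f g : ℝ → ℂ} (hf : IsPolyLT a k f) (hg : IsPolyLT a k g) :
    IsPolyLT a k (f + g) := by
  obtain ⟨v, rfl⟩ := hf
  obtain ⟨w, rfl⟩ := hg
  exact ⟨v + w, by ext x; simp [polyFn, add_mul, Finset.sum_add_distrib]⟩

theorem IsPolyLT.smul {a : ℝ} {k : ℕ} {g : ℝ → ℂ} (hg : IsPolyLT a k g) (c : ℂ) :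
    IsPolyLT a k (c • g) := by
  obtain ⟨v, rfl⟩ := hg
  exact ⟨c • v, by ext x; simp [polyFn, Finset.mul_sum, mul_assoc]⟩

theorem IsPolyLT.sub {a : ℝ} {k : ℕ} {f g : ℝ → ℂ} (hf : IsPolyLT a k f) (hg : IsPolyLT a k g) :
    IsPolyLT a k (f - g) := by
  have := hf.add (hg.smul (-1))
  simpa [sub_eq_add_neg] using this

theorem IsPolyLT.sum {ι : Type*} {a : ℝ} {k : ℕ} (s : Finset ι) {g : ι → ℝ → ℂ}
    (h : ∀ i ∈ s, IsPolyLT a k (g i)) : IsPolyLT a k (∑ i ∈ s, g i) := by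
  classical
  induction s using Finset.induction_on with
  | empty => simpa using IsPolyLT.zero a k
  | insert i s hi ih =>
    rw [Finset.sum_insert hi]
    exact (h i (by simp)).add (ih fun j hj => h j (by simp [hj]))

theorem IsPolyLT.mono {a : ℝ} {k l : ℕ} (hkl : k ≤ l) {g : ℝ → ℂ} (h : IsPolyLT a k g) :
    IsPolyLT a l g := by
  obtain ⟨v, rfl⟩ := h
  refine ⟨fun j => if j < k then v j else 0, ?_⟩
  ext x
  unfold polyFn
  rw [← Finset.sum_subset (Finset.range_mono hkl)]
  · exact Finset.sum_congr rfl fun j hj => by simp [Finset.mem_range.1 hj]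
  · intro j _ hj
    simp [Finset.mem_range] at hj
    simp [not_lt.2 hj]

theorem IsPolyLT.const (a : ℝ) (c : ℂ) : IsPolyLT a 1 fun _ => c :=
  ⟨fun _ => c, by ext x; simp [polyFn]⟩

theorem prim_polyFn (a : ℝ) (k : ℕ) (v : ℕ → ℂ) (x : ℝ) :
    prim a (polyFn a k v) x = ((x - a : ℝ) : ℂ) * polyFn a k (fun j => v j / (j + 1)) x := by
  have h : ∀ y, HasDerivAt
      (fun y : ℝ => ((y - a : ℝ) : ℂ) * polyFn a k (fun j => v j / (j + 1)) y)
      (polyFn a k v y) y := by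
    intro y
    have h0 : HasDerivAt (fun y : ℝ => ((y - a : ℝ) : ℂ)) 1 y := by
      simpa using ((hasDerivAt_id y).sub_const a).ofReal_comp
    have h1 : HasDerivAt (fun y : ℝ => ∑ j ∈ Finset.range k,
        (v j / (j + 1)) * ((y - a : ℝ) : ℂ) ^ (j + 1))
        (∑ j ∈ Finset.range k, v j * ((y - a : ℝ) : ℂ) ^ j) y := by
      refine HasDerivAt.fun_sum fun j _ => ?_
      refine ((h0.pow (j + 1)).const_mul (v j / (j + 1))).congr_deriv ?_
      have : (j : ℂ) + 1 ≠ 0 := Nat.cast_add_one_ne_zero j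
      simp only [Nat.add_sub_cancel, Nat.cast_add, Nat.cast_one, mul_one]
      field_simp
    refine h1.congr_of_eventuallyEq (Eventually.of_forall fun z => ?_)
    simp only [polyFn, Finset.mul_sum]
    exact Finset.sum_congr rfl fun j _ => by ring
  have := intervalIntegral.integral_eq_sub_of_hasDerivAt (fun y _ => h y)
    ((contDiff_polyFn a k v (n := 0)).continuous.intervalIntegrable a x)
  simpa [prim] using this

theorem IsPolyLT.prim {a : ℝ} {k : ℕ} {g : ℝ → ℂ} (h : IsPolyLT a k g) :
    IsPolyLT a (k + 1) (prim a g) := by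
  obtain ⟨v, rfl⟩ := h
  refine ⟨fun j => if j = 0 then 0 else v (j - 1) / j, ?_⟩
  ext x
  rw [prim_polyFn]
  simp only [polyFn]
  rw [Finset.sum_range_succ', Finset.mul_sum]
  simp only [Nat.add_eq_zero_iff, one_ne_zero, and_false, if_false, Nat.add_sub_cancel, if_true,
    zero_mul, add_zero, Nat.cast_add, Nat.cast_one]
  exact Finset.sum_congr rfl fun j _ => by ring

theorem IsPolyLT.primIter {a : ℝ} {k : ℕ} {g : ℝ → ℂ} (h : IsPolyLT a k g) (l : ℕ) :
    IsPolyLT a (k + l) ((BandODE.prim a)^[l] g) := by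
  induction l with
  | zero => exact h
  | succ l ih => rw [Function.iterate_succ_apply']; exact ih.prim

/-- The `k`-fold primitive of a `k`-th derivative differs from the function by a polynomial. -/
theorem primIter_iteratedDeriv (a : ℝ) (k : ℕ) {g : ℝ → ℂ} (hg : ContDiff ℝ k g) :
    IsPolyLT a k ((prim a)^[k] (iteratedDeriv k g) - g) := by
  induction k generalizing g with
  | zero => simpa using IsPolyLT.zero a 0
  | succ k ih =>
    have hg' : ContDiff ℝ k (deriv g) :=
      (contDiff_succ_iff_deriv.1 (by exact_mod_cast hg)).2.2
    have hg1 : ContDiff ℝ 1 g := hg.of_le (by exact_mod_cast Nat.le_add_left 1 k)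
    have hit : Continuous (iteratedDeriv k (deriv g)) := hg'.continuous_iteratedDeriv k le_rfl
    obtain h := (ih hg').prim
    rw [Function.iterate_succ_apply', iteratedDeriv_succ']
    have e : prim a ((prim a)^[k] (iteratedDeriv k (deriv g))) - g
        = prim a ((prim a)^[k] (iteratedDeriv k (deriv g)) - deriv g) - fun _ => g a := by
      have := primIter_sub (continuous_primIter hit a k) (hg1.continuous_deriv le_rfl) a 1
      simp only [Function.iterate_one] at this
      rw [this]
      ext x
      simp [prim_deriv hg1, sub_sub]
    rw [e]
    exact h.sub ((IsPolyLT.const a _).mono (by omega))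

/-- The coefficients of a polynomial are controlled by its primitive on a neighbourhood. -/
theorem exists_coeff_bound (a : ℝ) {δ : ℝ} (hδ : 0 < δ) (k : ℕ) :
    ∃ C, 0 ≤ C ∧ ∀ (v : ℕ → ℂ) (B : ℝ), (∀ x, |x - a| ≤ δ → ‖prim a (polyFn a k v) x‖ ≤ B) →
      ∀ j < k, ‖v j‖ ≤ C * B := by
  -- The nodes `a + y i` are distinct and differ from `a`, where every primitive vanishes.
  -- Evaluating the primitive there is a Vandermonde map up to nonzero factors, hence injective, and
  -- an injective linear map in finite dimension is bounded below.
  let y : Fin k → ℝ := fun i => δ * ((i : ℝ) + 1) / k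
  have hk : ∀ i : Fin k, (0 : ℝ) < k := fun i => by exact_mod_cast i.pos
  have hy0 : ∀ i, 0 < y i := fun i => by have := hk i; positivity
  have hyδ : ∀ i, y i ≤ δ := fun i => by
    have := hk i
    rw [div_le_iff₀ this]
    have : (i : ℝ) + 1 ≤ k := by exact_mod_cast i.isLt
    gcongr
  have hyinj : Function.Injective fun i => ((y i : ℝ) : ℂ) := by
    intro i j hij
    have h1 : y i = y j := Complex.ofReal_injective hij
    have h2 : δ * ((i : ℝ) + 1) = δ * ((j : ℝ) + 1) := by
      have := hk i
      simp only [y] at h1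
      field_simp at h1
      rw [h1]
    have h3 := mul_left_cancel₀ hδ.ne' h2
    have h4 : (i : ℝ) = j := by linarith
    exact Fin.ext (by exact_mod_cast h4)
  let T : (Fin k → ℂ) →ₗ[ℂ] (Fin k → ℂ) :=
    { toFun := fun v i => (y i : ℂ) * ∑ j : Fin k, v j / ((j : ℂ) + 1) * (y i : ℂ) ^ (j : ℕ)
      map_add' := fun v w => by
        ext i
        simp only [Pi.add_apply, add_div, add_mul, Finset.sum_add_distrib, mul_add]
      map_smul' := fun c v => by
        ext i
        simp only [Pi.smul_apply, smul_eq_mul, RingHom.id_apply, Finset.mul_sum]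
        exact Finset.sum_congr rfl fun j _ => by ring }
  have hker : LinearMap.ker T = ⊥ := by
    rw [LinearMap.ker_eq_bot']
    intro v hv
    have h0 := Matrix.eq_zero_of_forall_index_sum_pow_mul_eq_zero
      (v := fun j : Fin k => v j / ((j : ℂ) + 1)) hyinj fun i => by
        have := congrFun hv i
        simp only [T, LinearMap.coe_mk, AddHom.coe_mk, Pi.zero_apply, mul_eq_zero,
          Complex.ofReal_eq_zero, (hy0 i).ne', false_or] at this
        rw [← this]
        exact Finset.sum_congr rfl fun j _ => mul_comm _ _
    ext j
    have := congrFun h0 j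
    have hj : (j : ℂ) + 1 ≠ 0 := Nat.cast_add_one_ne_zero _
    simpa [hj] using this
  obtain ⟨K, hK, hT⟩ := T.exists_antilipschitzWith hker
  refine ⟨K, K.2, fun v B hB j hj => ?_⟩
  have hB0 : 0 ≤ B := (norm_nonneg _).trans (hB a (by simpa using hδ.le))
  have h1 := hT.le_mul_dist (fun i : Fin k => v i) 0
  rw [map_zero, dist_zero_right, dist_zero_right] at h1
  have h2 : ‖T fun i : Fin k => v i‖ ≤ B := by
    refine (pi_norm_le_iff_of_nonneg hB0).2 fun i => ?_
    have h3 := hB (a + y i) (by simpa [abs_of_pos (hy0 i)] using hyδ i)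
    rw [prim_polyFn, polyFn, add_sub_cancel_left, Finset.sum_range] at h3
    exact h3
  calc ‖v j‖ ≤ ‖fun i : Fin k => v i‖ := norm_le_pi_norm (fun i : Fin k => v i) ⟨j, hj⟩
    _ ≤ K * B := h1.trans (by gcongr)

/-! ### Oscillatory integrals -/

theorem exists_bound_near {g : ℝ → ℂ} (hg : Continuous g) (a δ : ℝ) :
    ∃ C, 0 ≤ C ∧ ∀ x, |x - a| ≤ δ → ‖g x‖ ≤ C := by
  obtain ⟨C, hC⟩ := (isCompact_closedBall a δ).exists_bound_of_continuousOn hg.continuousOn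
  exact ⟨max C 0, le_max_right _ _, fun x hx =>
    (hC x (by rwa [Metric.mem_closedBall, Real.dist_eq])).trans (le_max_left _ _)⟩

/-- Repeated integration by parts: up to polynomials of degree less than `k`, the `k`-fold
primitive of `g exp(iμθ)` is `O(|μ|^{-k})`, locally uniformly. -/
theorem primIter_oscillatory {n : ℕ} {θ : ℝ → ℝ} (hθ : ContDiff ℝ (n + 1 : ℕ) θ)
    (hθ0 : ∀ x, deriv θ x ≠ 0) (a : ℝ) {δ : ℝ} (hδ : 0 ≤ δ) (k : ℕ) (hk : k ≤ n)
    {g : ℝ → ℂ} (hg : ContDiff ℝ k g) :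
    ∃ C, 0 ≤ C ∧ ∀ μ : ℝ, μ ≠ 0 → ∃ Q, IsPolyLT a k Q ∧ ∀ x, |x - a| ≤ δ →
      ‖(prim a)^[k] (fun t => g t * Complex.exp (Complex.I * μ * θ t)) x - Q x‖
        ≤ C * (|μ| ^ k)⁻¹ := by
  induction k generalizing g with
  | zero =>
    obtain ⟨C, hC, h⟩ := exists_bound_near (hg.continuous) a δ
    refine ⟨C, hC, fun μ _ => ⟨0, IsPolyLT.zero a 0, fun x hx => ?_⟩⟩
    have : ‖Complex.exp (Complex.I * μ * θ x)‖ = 1 := by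
      rw [show Complex.I * μ * θ x = ((μ * θ x : ℝ) : ℂ) * Complex.I by push_cast; ring]
      exact Complex.norm_exp_ofReal_mul_I _
    simpa [this] using h x hx
  | succ k ih =>
    have hθ' : ContDiff ℝ (n : ℕ) (deriv θ) :=
      (contDiff_succ_iff_deriv.1 (by exact_mod_cast hθ)).2.2
    have hθd : ∀ x, HasDerivAt θ (deriv θ x) x := fun x =>
      ((hθ.differentiable (by exact_mod_cast Nat.succ_ne_zero n)) x).hasDerivAt
    -- With `G = g / θ'` one has `(G e)' = G' e + iμ g e`. One primitive of `g e` is therefore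
    -- `(iμ)⁻¹` times `G e`, a constant and a primitive of `G' e`; the induction hypothesis applies
    -- to both `G` and `G'`.
    set G : ℝ → ℂ := fun x => g x * ((deriv θ x)⁻¹ : ℝ) with hG
    have hGk : ContDiff ℝ (k + 1 : ℕ) G :=
      hg.mul (Complex.ofRealCLM.contDiff.comp
        ((hθ'.of_le (by exact_mod_cast hk)).inv hθ0))
    have hG1 : ContDiff ℝ 1 G := hGk.of_le (by exact_mod_cast Nat.le_add_left 1 k)
    have hGd : ContDiff ℝ k (deriv G) :=
      (contDiff_succ_iff_deriv.1 (by exact_mod_cast hGk)).2.2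
    obtain ⟨C₁, hC₁, h₁⟩ := ih (by omega) (hGk.of_le (by exact_mod_cast Nat.le_succ k))
    obtain ⟨C₂, hC₂, h₂⟩ := ih (by omega) hGd
    refine ⟨C₁ + δ * C₂, by positivity, fun μ hμ => ?_⟩
    obtain ⟨Q₁, hQ₁, hb₁⟩ := h₁ μ hμ
    obtain ⟨Q₂, hQ₂, hb₂⟩ := h₂ μ hμ
    set e : ℝ → ℂ := fun t => Complex.exp (Complex.I * μ * θ t) with he
    have hed : ∀ x, HasDerivAt e (e x * (Complex.I * μ * deriv θ x)) x := fun x =>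
      ((hθd x).ofReal_comp.const_mul (Complex.I * (μ : ℂ))).cexp
    have hec : Continuous e := continuous_iff_continuousAt.2 fun x => (hed x).continuousAt
    have hIμ : Complex.I * (μ : ℂ) ≠ 0 := by simp [hμ]
    have hGec : Continuous fun t => G t * e t := hGk.continuous.mul hec
    have hGdc : Continuous fun t => deriv G t * e t := hGd.continuous.mul hec
    have hprim : prim a (fun t => g t * e t) = (Complex.I * (μ : ℂ))⁻¹ •
        ((fun t => G t * e t) - (fun _ => G a * e a) - prim a fun t => deriv G t * e t) := by
      ext x
      have hgd : ∀ y, HasDerivAt (fun t => G t * e t)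
          (deriv G y * e y + (Complex.I * μ) * (g y * e y)) y := fun y => by
        refine (((hG1.differentiable one_ne_zero) y).hasDerivAt.mul (hed y)).congr_deriv ?_
        have : ((deriv θ y : ℝ) : ℂ) ≠ 0 := by exact_mod_cast hθ0 y
        simp only [hG, Complex.ofReal_inv]
        field_simp
      have hft := intervalIntegral.integral_eq_sub_of_hasDerivAt (fun y _ => hgd y)
        ((hGdc.add (continuous_const.mul (hg.continuous.mul hec))).intervalIntegrable a x)
      rw [intervalIntegral.integral_add (hGdc.intervalIntegrable _ _)
        (Continuous.intervalIntegrable (by have := hg.continuous; fun_prop) _ _),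
        intervalIntegral.integral_const_mul] at hft
      simp only [prim, Pi.smul_apply, Pi.sub_apply, smul_eq_mul]
      rw [← hft, eq_inv_mul_iff_mul_eq₀ hIμ]
      ring
    -- The boundary constant, integrated `k` times, and the primitive of `Q₂` are what raises the
    -- allowed degree by one.
    refine ⟨(Complex.I * (μ : ℂ))⁻¹ • (Q₁ - (prim a)^[k] (fun _ => G a * e a) - prim a Q₂),
      (((hQ₁.mono (Nat.le_succ k)).sub
        (((IsPolyLT.const a _).primIter k).mono (by omega))).sub hQ₂.prim).smul _, fun x hx => ?_⟩
    rw [Function.iterate_succ_apply, hprim, primIter_smul,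
      primIter_sub (hGec.sub continuous_const) (continuous_prim hGdc a),
      primIter_sub hGec continuous_const, ← Function.iterate_succ_apply (prim a),
      Function.iterate_succ_apply']
    have hbd : ‖prim a ((prim a)^[k] fun t => deriv G t * e t) x - prim a Q₂ x‖
        ≤ δ * (C₂ * (|μ| ^ k)⁻¹) := by
      have := primIter_sub (continuous_primIter hGdc a k) hQ₂.continuous a 1
      simp only [Function.iterate_one] at this
      rw [← Pi.sub_apply, ← this]
      exact norm_prim_le (fun y hy => hb₂ y hy) hx
    simp only [Pi.smul_apply, Pi.sub_apply, smul_eq_mul]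
    rw [← mul_sub, norm_mul, norm_inv, norm_mul, Complex.norm_I, one_mul, Complex.norm_real,
      Real.norm_eq_abs]
    calc |μ|⁻¹ * ‖_‖ ≤ |μ|⁻¹ * (C₁ * (|μ| ^ k)⁻¹ + δ * (C₂ * (|μ| ^ k)⁻¹)) := by
          gcongr
          refine le_trans (le_of_eq ?_) ((norm_sub_le _ _).trans (add_le_add (hb₁ x hx) hbd))
          congr 1
          ring
      _ = (C₁ + δ * C₂) * (|μ| ^ (k + 1))⁻¹ := by rw [pow_succ, mul_inv]; ring

/-! ### Divergence form of the differential operator -/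

theorem contDiffAt_deriv {n : ℕ} {f : ℝ → ℂ} {x : ℝ} (h : ContDiffAt ℝ (n + 1 : ℕ) f x) :
    ContDiffAt ℝ n (deriv f) x :=
  (h.fderiv_right (m := n) (by exact_mod_cast le_rfl)).clm_apply
    (contDiffAt_const (c := (1 : ℝ)))

theorem differentiableAt_iteratedDeriv {n k : ℕ} (hk : k ≤ n) {f : ℝ → ℂ} {x : ℝ}
    (h : ContDiffAt ℝ (n + 1 : ℕ) f x) : DifferentiableAt ℝ (iteratedDeriv k f) x := by
  have h' : ContDiffAt ℝ (k + 1 : ℕ) f x := h.of_le (by exact_mod_cast Nat.succ_le_succ hk)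
  clear h
  induction k generalizing f with
  | zero =>
    rw [iteratedDeriv_zero]
    exact h'.differentiableAt (by simp)
  | succ k ih =>
    rw [iteratedDeriv_succ']
    exact ih (by omega) (contDiffAt_deriv h')

/-- A term `p u^{(m)}` in divergence form. -/
theorem exists_divergence_form_term (m : ℕ) {p : ℝ → ℂ} (hp : ContDiff ℝ ∞ p) :
    ∃ q : ℕ → ℝ → ℂ, (∀ j, ContDiff ℝ ∞ (q j)) ∧ q m = p ∧ (∀ j, m < j → q j = 0) ∧
      ∀ u x, ContDiffAt ℝ m u x →
        p x * iteratedDeriv m u x = ∑ j ∈ Finset.range (m + 1), iteratedDeriv j (q j * u) x := by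
  induction m generalizing p with
  | zero =>
    refine ⟨fun j => if j = 0 then p else 0, fun j => ?_, by simp, fun j hj => by simp [hj.ne'],
      fun u x _ => by simp⟩
    dsimp only
    split_ifs
    · exact hp
    · exact contDiff_const
  | succ m ih =>
    have hp' : ContDiff ℝ ∞ (deriv p) := (contDiff_infty_iff_deriv.1 hp).2
    obtain ⟨q, hq, hqm, hq0, hqu⟩ := ih hp
    obtain ⟨r, hr, hrm, hr0, hru⟩ := ih hp'
    -- From `p u^{(m+1)} = (p u^{(m)})' - p' u^{(m)}`: differentiating the form for `p` shifts its
    -- coefficients by one index, which gives `A`, and `r` is the form for `p'`.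
    let A : ℕ → ℝ → ℂ := fun j => if j = 0 then 0 else q (j - 1)
    have hA : ∀ j, ContDiff ℝ ∞ (A j) := fun j => by
      simp only [A]
      split_ifs
      · exact contDiff_const
      · exact hq _
    refine ⟨fun j => A j - r j, fun j => (hA j).sub (hr j), ?_, fun j hj => ?_, fun u x hu => ?_⟩
    · simp [A, hqm, hr0 (m + 1) (Nat.lt_succ_self m)]
    · have : j ≠ 0 := by omega
      simp [A, this, hq0 (j - 1) (by omega), hr0 j (by omega)]
    have hu' : ContDiffAt ℝ m u x := hu.of_le (by exact_mod_cast Nat.le_succ m)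
    have hmul : ∀ g : ℝ → ℂ, ContDiff ℝ ∞ g → ContDiffAt ℝ (m + 1 : ℕ) (g * u) x := fun g hg =>
      (hg.contDiffAt.of_le (by exact_mod_cast le_top)).mul hu
    have hev : (fun y => p y * iteratedDeriv m u y) =ᶠ[𝓝 x]
        fun y => ∑ j ∈ Finset.range (m + 1), iteratedDeriv j (q j * u) y := by
      filter_upwards [hu'.eventually (by simp)] with y hy using hqu u y hy
    have hd := hev.deriv_eq
    have hum : DifferentiableAt ℝ (iteratedDeriv m u) x := differentiableAt_iteratedDeriv le_rfl hu
    rw [deriv_fun_mul ((hp.differentiable (by simp)) x) hum, hru u x hu',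
      deriv_fun_sum fun j hj => differentiableAt_iteratedDeriv
        (Nat.lt_succ_iff.1 (Finset.mem_range.1 hj)) (hmul _ (hq j)), ← iteratedDeriv_succ] at hd
    have hsplit : ∀ j ∈ Finset.range (m + 1 + 1), iteratedDeriv j ((A j - r j) * u) x
        = iteratedDeriv j (A j * u) x - iteratedDeriv j (r j * u) x := by
      intro j hj
      have hj' : ((j : ℕ) : WithTop ℕ∞) ≤ ((m + 1 : ℕ) : WithTop ℕ∞) := by
        exact_mod_cast Nat.lt_succ_iff.1 (Finset.mem_range.1 hj)
      rw [sub_mul, iteratedDeriv_sub ((hmul _ (hA j)).of_le hj') ((hmul _ (hr j)).of_le hj')]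
    rw [Finset.sum_congr rfl hsplit, Finset.sum_sub_distrib, Finset.sum_range_succ',
      Finset.sum_range_succ (fun j => iteratedDeriv j (r j * u) x) (m + 1),
      hr0 (m + 1) (Nat.lt_succ_self m)]
    have e1 : iteratedDeriv 0 (A 0 * u) x = 0 := by simp [A]
    have e2 : iteratedDeriv (m + 1) (0 * u) x = 0 := by
      rw [zero_mul]
      simp
    have e3 : ∑ j ∈ Finset.range (m + 1), iteratedDeriv (j + 1) (A (j + 1) * u) x
        = ∑ j ∈ Finset.range (m + 1), deriv (iteratedDeriv j (q j * u)) x :=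
      Finset.sum_congr rfl fun j _ => by rw [iteratedDeriv_succ]; simp [A]
    rw [e1, e2, e3, ← hd]
    ring

/-- The operator `P(lam; x, d/dx)` in divergence form. -/
theorem exists_divergence_form {M : ℕ} (hM : 1 ≤ M) {p : ℕ → ℝ → ℂ}
    (hp : ∀ m ≤ M, ContDiff ℝ ∞ (p m)) (lam : ℂ) :
    ∃ q : ℕ → ℝ → ℂ, (∀ j, ContDiff ℝ ∞ (q j)) ∧ q M = p M ∧
      ∀ u x, ContDiffAt ℝ M u x →
        shiftedOp M p lam u x = ∑ j ∈ Finset.range (M + 1), iteratedDeriv j (q j * u) x := by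
  have key : ∀ m, ∃ q : ℕ → ℝ → ℂ, (∀ j, ContDiff ℝ ∞ (q j)) ∧ (m ≤ M → q m = p m) ∧
      (∀ j, m < j → q j = 0) ∧ (m ≤ M → ∀ u x, ContDiffAt ℝ m u x →
        p m x * iteratedDeriv m u x
          = ∑ j ∈ Finset.range (m + 1), iteratedDeriv j (q j * u) x) := by
    intro m
    by_cases hm : m ≤ M
    · obtain ⟨q, h1, h2, h3, h4⟩ := exists_divergence_form_term m (hp m hm)
      exact ⟨q, h1, fun _ => h2, h3, fun _ => h4⟩
    · exact ⟨0, fun j => contDiff_const, fun h => absurd h hm, fun j _ => rfl,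
        fun h => absurd h hm⟩
  choose q hq hqm hq0 hqu using key
  -- The spectral parameter enters only at `j = 0`, so `q M = p M` uses `1 ≤ M`.
  let L : ℕ → ℝ → ℂ := fun j => if j = 0 then fun _ => lam else 0
  have hL : ∀ j, ContDiff ℝ ∞ (L j) := fun j => by
    simp only [L]
    split_ifs <;> exact contDiff_const
  refine ⟨fun j => (∑ m ∈ Finset.range (M + 1), q m j) - L j, fun j => ?_, ?_, fun u x hu => ?_⟩
  · have : ContDiff ℝ ∞ fun x => ∑ m ∈ Finset.range (M + 1), q m j x :=
      ContDiff.sum fun m _ => hq m j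
    convert this.sub (hL j) using 1
    ext x
    simp
  · dsimp only
    rw [Finset.sum_range_succ, Finset.sum_eq_zero fun m hm => hq0 m M (Finset.mem_range.1 hm)]
    have : M ≠ 0 := by omega
    simp [L, this, hqm M le_rfl]
  have hmul : ∀ j ∈ Finset.range (M + 1), ∀ g : ℝ → ℂ, ContDiff ℝ ∞ g →
      ContDiffAt ℝ j (g * u) x := fun j hj g hg =>
    (hg.contDiffAt.of_le (by exact_mod_cast le_top)).mul
      (hu.of_le (by exact_mod_cast Nat.lt_succ_iff.1 (Finset.mem_range.1 hj)))
  have hsum : ∀ j ∈ Finset.range (M + 1),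
      iteratedDeriv j (((∑ m ∈ Finset.range (M + 1), q m j) - L j) * u) x
      = ∑ m ∈ Finset.range (M + 1), iteratedDeriv j (q m j * u) x
        - iteratedDeriv j (L j * u) x := by
    intro j hj
    rw [sub_mul, Finset.sum_mul, iteratedDeriv_sub _ (hmul j hj _ (hL j)),
      iteratedDeriv_sum fun m _ => hmul j hj _ (hq m j)]
    have : ContDiffAt ℝ j (fun y => ∑ m ∈ Finset.range (M + 1), (q m j * u) y) x :=
      ContDiffAt.sum fun m _ => hmul j hj _ (hq m j)
    exact this.congr_of_eventuallyEq (Eventually.of_forall fun y => by simp)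
  have hz : ∀ j, iteratedDeriv j (0 : ℝ → ℂ) x = 0 := fun j => by
    simp
  rw [Finset.sum_congr rfl hsum, Finset.sum_sub_distrib, Finset.sum_comm, shiftedOp, diffOp]
  congr 1
  · refine Finset.sum_congr rfl fun m hm => ?_
    have hmM : m ≤ M := Nat.lt_succ_iff.1 (Finset.mem_range.1 hm)
    rw [hqu m hmM u x (hu.of_le (by exact_mod_cast hmM))]
    refine Finset.sum_subset (Finset.range_mono (by omega)) fun j _ hj => ?_
    rw [hq0 m j (by simpa [Nat.lt_succ_iff] using hj), zero_mul, hz]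
  · rw [Finset.sum_range_succ', Finset.sum_eq_zero]
    · simp [L]
    · intro j _
      simp [L, hz]

/-! ### The integrated equation: estimate, limits, regularity -/

/-- The `M`-fold primitive of `∑ j, (q j u)^{(j)}`, up to a polynomial. -/
def divInt (M : ℕ) (q : ℕ → ℝ → ℂ) (a : ℝ) (u : ℝ → ℂ) : ℝ → ℂ :=
  ∑ j ∈ Finset.range (M + 1), (prim a)^[M - j] (q j * u)

theorem divInt_sub {M : ℕ} {q : ℕ → ℝ → ℂ} (hq : ∀ j, Continuous (q j)) (a : ℝ) {u v : ℝ → ℂ}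
    (hu : Continuous u) (hv : Continuous v) :
    divInt M q a (u - v) = divInt M q a u - divInt M q a v := by
  unfold divInt
  rw [← Finset.sum_sub_distrib]
  exact Finset.sum_congr rfl fun j _ => by
    rw [mul_sub, primIter_sub ((hq j).mul hu) ((hq j).mul hv)]

theorem continuous_divInt {M : ℕ} {q : ℕ → ℝ → ℂ} (hq : ∀ j, Continuous (q j)) (a : ℝ)
    {u : ℝ → ℂ} (hu : Continuous u) : Continuous (divInt M q a u) := by
  have : Continuous fun x => ∑ j ∈ Finset.range (M + 1), (prim a)^[M - j] (q j * u) x :=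
    continuous_finsetSum _ fun j _ => continuous_primIter ((hq j).mul hu) a _
  convert this using 1
  ext x
  simp [divInt]

/-- Of the `M` primitives of a `j`-th derivative, `j` cancel up to a polynomial of degree less than
`j`, and the remaining `M - j` raise that degree to less than `M`. -/
theorem primIter_divergence {M : ℕ} {q : ℕ → ℝ → ℂ} (hq : ∀ j, ContDiff ℝ ∞ (q j)) (a : ℝ)
    {u r : ℝ → ℂ} (hu : ContDiff ℝ M u)
    (hr : ∀ x, r x = ∑ j ∈ Finset.range (M + 1), iteratedDeriv j (q j * u) x) :
    IsPolyLT a M ((prim a)^[M] r - divInt M q a u) := by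
  have hmul : ∀ j ∈ Finset.range (M + 1), ContDiff ℝ j (q j * u) := fun j hj =>
    ((hq j).of_le (by exact_mod_cast le_top)).mul
      (hu.of_le (by exact_mod_cast Nat.lt_succ_iff.1 (Finset.mem_range.1 hj)))
  have hr' : r = ∑ j ∈ Finset.range (M + 1), iteratedDeriv j (q j * u) := by
    ext x
    rw [hr, Finset.sum_apply]
  rw [hr', primIter_sum _ _ fun j hj => (hmul j hj).continuous_iteratedDeriv j le_rfl, divInt,
    ← Finset.sum_sub_distrib]
  refine IsPolyLT.sum _ fun j hj => ?_
  have hjM : j ≤ M := Nat.lt_succ_iff.1 (Finset.mem_range.1 hj)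
  have h := (primIter_iteratedDeriv a j (hmul j hj)).primIter (M - j)
  rw [primIter_sub (continuous_primIter ((hmul j hj).continuous_iteratedDeriv j le_rfl) a j)
    (hmul j hj).continuous, ← Function.iterate_add_apply, Nat.sub_add_cancel hjM,
    Nat.add_sub_cancel' hjM] at h
  exact h

/-- The a priori estimate: a function is controlled by its weak norms and the distance of
`divInt` to polynomials. -/
theorem exists_apriori {M : ℕ} {q : ℕ → ℝ → ℂ} (hq : ∀ j, Continuous (q j)) (a : ℝ) {δ : ℝ}
    (hδ : 0 < δ) (hqM : ∀ x, |x - a| ≤ δ → q M x ≠ 0) :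
    ∃ C, 0 ≤ C ∧ ∀ (u : ℝ → ℂ) (v : ℕ → ℂ) (ε : ℝ), Continuous u →
      (∀ x, |x - a| ≤ δ → ‖divInt M q a u x - polyFn a M v x‖ ≤ ε) →
      (∀ j ≤ M, ∀ x, |x - a| ≤ δ → ‖prim a (q j * u) x‖ ≤ ε) →
      (∀ x, |x - a| ≤ δ → ‖u x‖ ≤ C * ε) ∧ ∀ j < M, ‖v j‖ ≤ C * ε := by
  obtain ⟨K, hK, hcoef⟩ := exists_coeff_bound a hδ M
  obtain ⟨c, hc, hinv⟩ : ∃ c, 0 ≤ c ∧ ∀ x, |x - a| ≤ δ → ‖(q M x)⁻¹‖ ≤ c := by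
    have hcont : ContinuousOn (fun x => (q M x)⁻¹) (Metric.closedBall a δ) :=
      (hq M).continuousOn.inv₀ fun x hx => hqM x (by rwa [← Real.dist_eq])
    obtain ⟨C, hC⟩ := (isCompact_closedBall a δ).exists_bound_of_continuousOn hcont
    exact ⟨max C 0, le_max_right _ _, fun x hx =>
      (hC x (by rwa [Metric.mem_closedBall, Real.dist_eq])).trans (le_max_left _ _)⟩
  set S₁ : ℝ := ∑ j ∈ Finset.range (M + 1), δ ^ (M - j) with hS₁
  set S₂ : ℝ := ∑ j ∈ Finset.range M, δ ^ (M - 1 - j) with hS₂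
  set S₃ : ℝ := ∑ j ∈ Finset.range M, δ ^ j with hS₃
  have hS₁0 : 0 ≤ S₁ := Finset.sum_nonneg fun j _ => by positivity
  have hS₂0 : 0 ≤ S₂ := Finset.sum_nonneg fun j _ => by positivity
  have hS₃0 : 0 ≤ S₃ := Finset.sum_nonneg fun j _ => by positivity
  refine ⟨c * (1 + K * (S₁ + δ) * S₃ + S₂) + K * (S₁ + δ), by positivity,
    fun u v ε hu hdiv hw => ?_⟩
  have hε : 0 ≤ ε := (norm_nonneg _).trans (hdiv a (by simpa using hδ.le))
  have hmul : ∀ j, Continuous (q j * u) := fun j => (hq j).mul hu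
  have hdc := continuous_divInt (M := M) hq a hu
  have hpc : Continuous (polyFn a M v) := (contDiff_polyFn a M v (n := 0)).continuous
  -- No bound on `u` is available yet, but after one more primitive every term of `divInt` is an
  -- iterated primitive of some `prim a (q j * u)`, which is at most `ε`. The polynomial is then
  -- read off from its own primitive.
  have hv : ∀ j < M, ‖v j‖ ≤ K * ((S₁ + δ) * ε) := by
    refine hcoef v _ fun x hx => ?_
    have e1 : prim a (polyFn a M v)
        = prim a (divInt M q a u) - prim a (divInt M q a u - polyFn a M v) := by
      have := primIter_sub hdc hpc a 1
      simp only [Function.iterate_one] at this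
      rw [this]
      abel
    have e2 : prim a (divInt M q a u)
        = ∑ j ∈ Finset.range (M + 1), (prim a)^[M - j] (prim a (q j * u)) := by
      have := primIter_sum (Finset.range (M + 1)) (fun j => (prim a)^[M - j] (q j * u))
        (fun j _ => continuous_primIter (hmul j) a _) a 1
      simp only [Function.iterate_one] at this
      rw [divInt, this]
      exact Finset.sum_congr rfl fun j _ => by
        rw [← Function.iterate_succ_apply (prim a), Function.iterate_succ_apply']
    rw [e1, e2, Pi.sub_apply, Finset.sum_apply]
    calc _ ≤ (∑ j ∈ Finset.range (M + 1), δ ^ (M - j) * ε) + δ * ε := by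
          refine (norm_sub_le _ _).trans (add_le_add ((norm_sum_le _ _).trans
            (Finset.sum_le_sum fun j hj => ?_)) (norm_prim_le hdiv hx))
          exact norm_primIter_le (hw j (Nat.lt_succ_iff.1 (Finset.mem_range.1 hj))) _ hx
      _ = (S₁ + δ) * ε := by rw [← Finset.sum_mul, add_mul]
  refine ⟨fun x hx => ?_, fun j hj => (hv j hj).trans ?_⟩
  -- The term `j = M` is the only one without a primitive; solving for it bounds `q M * u`.
  · have h1 : q M x * u x = (divInt M q a u x - polyFn a M v x) + polyFn a M v x
        - ∑ j ∈ Finset.range M, (prim a)^[M - 1 - j] (prim a (q j * u)) x := by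
      rw [sub_add_cancel, divInt, Finset.sum_range_succ, Pi.add_apply, Finset.sum_apply,
        Nat.sub_self, Function.iterate_zero, id, Pi.mul_apply]
      rw [eq_sub_iff_add_eq, add_comm]
      congr 1
      refine Finset.sum_congr rfl fun j hj => ?_
      have : M - j = M - 1 - j + 1 := by have := Finset.mem_range.1 hj; omega
      rw [this, Function.iterate_succ_apply]
    have h2 : ‖polyFn a M v x‖ ≤ K * ((S₁ + δ) * ε) * S₃ := by
      rw [hS₃, Finset.mul_sum]
      refine (norm_sum_le _ _).trans (Finset.sum_le_sum fun j hj => ?_)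
      rw [norm_mul, norm_pow, Complex.norm_real, Real.norm_eq_abs]
      exact mul_le_mul (hv j (Finset.mem_range.1 hj)) (by gcongr) (by positivity) (by positivity)
    have h3 : ‖∑ j ∈ Finset.range M, (prim a)^[M - 1 - j] (prim a (q j * u)) x‖ ≤ S₂ * ε := by
      rw [hS₂, Finset.sum_mul]
      exact (norm_sum_le _ _).trans (Finset.sum_le_sum fun j hj =>
        norm_primIter_le (hw j (Finset.mem_range.1 hj).le) _ hx)
    have h4 : ‖q M x * u x‖ ≤ ε + K * ((S₁ + δ) * ε) * S₃ + S₂ * ε := by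
      rw [h1]
      exact (norm_sub_le _ _).trans (add_le_add ((norm_add_le _ _).trans
        (add_le_add (hdiv x hx) h2)) h3)
    have h5 : u x = (q M x)⁻¹ * (q M x * u x) := by
      rw [inv_mul_cancel_left₀ (hqM x hx)]
    rw [h5, norm_mul]
    calc _ ≤ c * (ε + K * ((S₁ + δ) * ε) * S₃ + S₂ * ε) := by
          gcongr
          exact hinv x hx
      _ ≤ _ := by
          have : 0 ≤ K * (S₁ + δ) * ε := mul_nonneg (mul_nonneg hK (add_nonneg hS₁0 hδ.le)) hε
          linarith
  · have : 0 ≤ c * (1 + K * (S₁ + δ) * S₃ + S₂) * ε := by positivity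
    linarith

theorem polyFn_sub (a : ℝ) (k : ℕ) (v w : ℕ → ℂ) (x : ℝ) :
    polyFn a k (v - w) x = polyFn a k v x - polyFn a k w x := by
  simp [polyFn, sub_mul, Finset.sum_sub_distrib]

/-- Approximate solutions of the integrated equation that converge weakly converge pointwise to
a continuous solution of the integrated equation. -/
theorem exists_limit_solution {M : ℕ} {q : ℕ → ℝ → ℂ} (hq : ∀ j, Continuous (q j)) (a : ℝ)
    {δ : ℝ} (hδ : 0 < δ) (hqM : ∀ x, |x - a| ≤ δ → q M x ≠ 0) (u : ℕ → ℝ → ℂ)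
    (hu : ∀ n, Continuous (u n)) (v : ℕ → ℕ → ℂ)
    (hdiv : ∀ ε > 0, ∃ N₀, ∀ N ≥ N₀, ∀ x, |x - a| ≤ δ →
      ‖divInt M q a (u N) x - polyFn a M (v N) x‖ ≤ ε)
    (hweak : ∀ ε > 0, ∃ N₀, ∀ N ≥ N₀, ∀ N' ≥ N₀, ∀ j ≤ M, ∀ x, |x - a| ≤ δ →
      ‖prim a (q j * (u N - u N')) x‖ ≤ ε) :
    ∃ (φ : ℝ → ℂ) (w : ℕ → ℂ), Continuous φ ∧
      (∀ x, |x - a| ≤ δ → Tendsto (fun N => u N x) atTop (𝓝 (φ x))) ∧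
      ∀ x, |x - a| ≤ δ → divInt M q a φ x = polyFn a M w x := by
  obtain ⟨C, hC, hap⟩ := exists_apriori hq a hδ hqM
  have hcauchy : ∀ ε > 0, ∃ N₀, ∀ N ≥ N₀, ∀ N' ≥ N₀,
      (∀ x, |x - a| ≤ δ → ‖u N x - u N' x‖ < ε) ∧ ∀ j < M, ‖v N j - v N' j‖ < ε := by
    intro ε hε
    set η := ε / (2 * (C + 1)) with hη
    have hη0 : 0 < η := by positivity
    have hCη : C * η < ε := by
      have : (C + 1) * η = ε / 2 := by rw [hη]; field_simp
      nlinarith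
    obtain ⟨N₁, h₁⟩ := hdiv (η / 2) (by positivity)
    obtain ⟨N₂, h₂⟩ := hweak η hη0
    refine ⟨max N₁ N₂, fun N hN N' hN' => ?_⟩
    obtain ⟨ha, hb⟩ := hap (u N - u N') (v N - v N') η ((hu N).sub (hu N')) (fun x hx => by
      rw [divInt_sub hq a (hu N) (hu N'), polyFn_sub, Pi.sub_apply, sub_sub_sub_comm]
      refine (norm_sub_le _ _).trans ?_
      have e1 := h₁ N (le_of_max_le_left hN) x hx
      have e2 := h₁ N' (le_of_max_le_left hN') x hx
      linarith) (fun j hj x hx => h₂ N (le_of_max_le_right hN) N' (le_of_max_le_right hN') j hj x hx)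
    exact ⟨fun x hx => (ha x hx).trans_lt hCη, fun j hj => (hb j hj).trans_lt hCη⟩
  have hJ : ∀ x, x ∈ Set.Icc (a - δ) (a + δ) ↔ |x - a| ≤ δ := fun x => by
    rw [abs_le, Set.mem_Icc]
    constructor <;> rintro ⟨h, h'⟩ <;> constructor <;> linarith
  have hlim : ∀ x, ∃ l, |x - a| ≤ δ → Tendsto (fun N => u N x) atTop (𝓝 l) := by
    intro x
    by_cases hx : |x - a| ≤ δ
    · have : CauchySeq fun N => u N x := Metric.cauchySeq_iff.2 fun ε hε => by
        obtain ⟨N₀, h⟩ := hcauchy ε hε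
        exact ⟨N₀, fun m hm n hn => by rw [dist_eq_norm]; exact (h m hm n hn).1 x hx⟩
      obtain ⟨l, hl⟩ := cauchySeq_tendsto_of_complete this
      exact ⟨l, fun _ => hl⟩
    · exact ⟨0, fun h => absurd h hx⟩
  choose φ₀ hφ₀ using hlim
  have hvlim : ∀ j, ∃ l, j < M → Tendsto (fun N => v N j) atTop (𝓝 l) := by
    intro j
    by_cases hj : j < M
    · have : CauchySeq fun N => v N j := Metric.cauchySeq_iff.2 fun ε hε => by
        obtain ⟨N₀, h⟩ := hcauchy ε hε
        exact ⟨N₀, fun m hm n hn => by rw [dist_eq_norm]; exact (h m hm n hn).2 j hj⟩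
      obtain ⟨l, hl⟩ := cauchySeq_tendsto_of_complete this
      exact ⟨l, fun _ => hl⟩
    · exact ⟨0, fun h => absurd h hj⟩
  choose w hw using hvlim
  have hunif : TendstoUniformlyOn u φ₀ atTop (Set.Icc (a - δ) (a + δ)) := by
    refine UniformCauchySeqOn.tendstoUniformlyOn_of_tendsto ?_ fun x hx => hφ₀ x ((hJ x).1 hx)
    refine Metric.uniformCauchySeqOn_iff.2 fun ε hε => ?_
    obtain ⟨N₀, h⟩ := hcauchy ε hε
    exact ⟨N₀, fun m hm n hn x hx => by rw [dist_eq_norm]; exact (h m hm n hn).1 x ((hJ x).1 hx)⟩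
  have hφ₀c : ContinuousOn φ₀ (Set.Icc (a - δ) (a + δ)) :=
    hunif.continuousOn (Frequently.of_forall fun N => (hu N).continuousOn)
  have hle : a - δ ≤ a + δ := by linarith
  -- The limit is meaningful only on the closed interval; extending it by its endpoint values makes
  -- it continuous on the line, as the primitives require.
  set φ : ℝ → ℂ := Set.IccExtend hle ((Set.Icc (a - δ) (a + δ)).domRestrict φ₀) with hφ
  have hφc : Continuous φ := Continuous.Icc_extend' (continuousOn_iff_continuous_domRestrict.1 hφ₀c)
  have hφeq : ∀ x, |x - a| ≤ δ → φ x = φ₀ x := fun x hx =>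
    Set.IccExtend_of_mem hle _ ((hJ x).2 hx)
  refine ⟨φ, w, hφc, fun x hx => by rw [hφeq x hx]; exact hφ₀ x hx, fun x hx => ?_⟩
  have hterm : ∀ j, Tendsto (fun N => (prim a)^[M - j] (q j * u N) x) atTop
      (𝓝 ((prim a)^[M - j] (q j * φ) x)) := by
    intro j
    obtain ⟨K, hK, hqK⟩ := exists_bound_near (hq j) a δ
    rw [Metric.tendsto_atTop]
    intro ε hε
    set η := ε / (2 * (δ ^ (M - j) * K + 1)) with hη
    have hD : 0 ≤ δ ^ (M - j) * K := by positivity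
    have hη0 : 0 < η := by positivity
    have hDη : δ ^ (M - j) * (K * η) < ε := by
      have : (δ ^ (M - j) * K + 1) * η = ε / 2 := by rw [hη]; field_simp
      nlinarith
    obtain ⟨N₀, hN₀⟩ := eventually_atTop.1 (Metric.tendstoUniformlyOn_iff.1 hunif η hη0)
    refine ⟨N₀, fun N hN => ?_⟩
    rw [dist_eq_norm, ← Pi.sub_apply, ← primIter_sub ((hq j).mul (hu N)) ((hq j).mul hφc),
      ← mul_sub]
    refine (norm_primIter_le (B := K * η) (fun y hy => ?_) _ hx).trans_lt hDη
    rw [Pi.mul_apply, norm_mul, Pi.sub_apply, hφeq y hy]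
    have h1 := hN₀ N hN y ((hJ y).2 hy)
    rw [dist_comm, dist_eq_norm] at h1
    have h2 := hqK y hy
    gcongr
  have h1 : Tendsto (fun N => divInt M q a (u N) x) atTop (𝓝 (divInt M q a φ x)) := by
    simp only [divInt, Finset.sum_apply]
    exact tendsto_finsetSum _ fun j _ => hterm j
  have h2 : Tendsto (fun N => polyFn a M (v N) x) atTop (𝓝 (polyFn a M w x)) := by
    unfold polyFn
    exact tendsto_finsetSum _ fun j hj => (hw j (Finset.mem_range.1 hj)).mul_const _
  have h3 : Tendsto (fun N => divInt M q a (u N) x - polyFn a M (v N) x) atTop (𝓝 0) := by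
    rw [Metric.tendsto_atTop]
    intro ε hε
    obtain ⟨N₀, h⟩ := hdiv (ε / 2) (by positivity)
    exact ⟨N₀, fun N hN => by
      rw [dist_zero_right]
      have := h N hN x hx
      linarith⟩
  exact sub_eq_zero.1 (tendsto_nhds_unique (h1.sub h2) h3)

theorem contDiffOn_primIter {g : ℝ → ℂ} (hg : Continuous g) (a : ℝ) {s : Set ℝ} (hs : IsOpen s)
    {k : ℕ} (h : ContDiffOn ℝ k g s) (l : ℕ) :
    ContDiffOn ℝ (k + l : ℕ) ((prim a)^[l] g) s := by
  induction l with
  | zero => exact h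
  | succ l ih =>
    rw [Function.iterate_succ_apply']
    have hc := continuous_primIter hg a l
    rw [← add_assoc, Nat.cast_add, Nat.cast_one, contDiffOn_succ_iff_deriv_of_isOpen hs,
      deriv_prim hc]
    exact ⟨fun x _ => (hasDerivAt_prim hc a x).differentiableAt.differentiableWithinAt,
      by simp, ih⟩

theorem iteratedDeriv_primIter {g : ℝ → ℂ} (hg : Continuous g) (a : ℝ) (l j : ℕ) :
    iteratedDeriv (l + j) ((prim a)^[l] g) = iteratedDeriv j g := by
  induction l with
  | zero => simp
  | succ l ih =>
    rw [Function.iterate_succ_apply', show l + 1 + j = l + j + 1 by omega, iteratedDeriv_succ',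
      deriv_prim (continuous_primIter hg a l), ih]

theorem deriv_polyFn (a : ℝ) (k : ℕ) (v : ℕ → ℂ) :
    deriv (polyFn a (k + 1) v) = polyFn a k fun j => (j + 1) * v (j + 1) := by
  ext x
  have h0 : HasDerivAt (fun y : ℝ => ((y - a : ℝ) : ℂ)) 1 x := by
    simpa using ((hasDerivAt_id x).sub_const a).ofReal_comp
  have h1 : HasDerivAt (polyFn a (k + 1) v)
      (∑ j ∈ Finset.range (k + 1), v j * (j * ((x - a : ℝ) : ℂ) ^ (j - 1) * 1)) x :=
    HasDerivAt.fun_sum fun j _ => (h0.pow j).const_mul (v j)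
  rw [h1.deriv, Finset.sum_range_succ', polyFn]
  simp only [Nat.cast_zero, zero_mul, mul_zero, add_zero, Nat.add_sub_cancel, Nat.cast_add,
    Nat.cast_one]
  exact Finset.sum_congr rfl fun j _ => by ring

theorem iteratedDeriv_polyFn (a : ℝ) (k : ℕ) (v : ℕ → ℂ) : iteratedDeriv k (polyFn a k v) = 0 := by
  induction k generalizing v with
  | zero => ext x; simp [polyFn]
  | succ k ih => rw [iteratedDeriv_succ', deriv_polyFn, ih]

/-- A continuous solution of the integrated equation is a classical solution. -/
theorem contDiffOn_and_solution {M : ℕ} {q : ℕ → ℝ → ℂ} (hq : ∀ j, ContDiff ℝ ∞ (q j)) (a : ℝ)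
    {δ : ℝ} (hqM : ∀ x, |x - a| ≤ δ → q M x ≠ 0) {φ : ℝ → ℂ} (hφ : Continuous φ)
    {w : ℕ → ℂ} (h : ∀ x, |x - a| ≤ δ → divInt M q a φ x = polyFn a M w x) :
    ContDiffOn ℝ M φ (Metric.ball a δ) ∧ ∀ x ∈ Metric.ball a δ,
      ∑ j ∈ Finset.range (M + 1), iteratedDeriv j (q j * φ) x = 0 := by
  have hJ : ∀ x ∈ Metric.ball a δ, |x - a| ≤ δ := fun x hx => by
    rw [Metric.mem_ball, Real.dist_eq] at hx
    exact hx.le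
  have hmulc : ∀ j, Continuous (q j * φ) := fun j => (hq j).continuous.mul hφ
  have hmul : ∀ (k : ℕ) j, ContDiffOn ℝ k φ (Metric.ball a δ) →
      ContDiffOn ℝ k (q j * φ) (Metric.ball a δ) := fun k j hk =>
    ((hq j).of_le (by exact_mod_cast le_top)).contDiffOn.mul hk
  have hboot : ∀ k ≤ M, ContDiffOn ℝ k φ (Metric.ball a δ) := by
    intro k hk
    induction k with
    | zero => exact contDiffOn_zero.2 hφ.continuousOn
    | succ k ih =>
      have hk' := ih (by omega)
      -- In the equation solved for `φ`, every occurrence of `φ` on the right stands under at least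
      -- one primitive, so the right side has one derivative more than `φ`.
      have heq : ∀ x ∈ Metric.ball a δ, φ x = (polyFn a M w x
          - ∑ j ∈ Finset.range M, (prim a)^[M - j] (q j * φ) x) * (q M x)⁻¹ := by
        intro x hx
        have h1 := h x (hJ x hx)
        rw [divInt, Finset.sum_range_succ, Pi.add_apply, Finset.sum_apply, Nat.sub_self,
          Function.iterate_zero, id, Pi.mul_apply] at h1
        rw [← h1, add_sub_cancel_left, mul_comm (q M x), mul_assoc,
          mul_inv_cancel₀ (hqM x (hJ x hx)), mul_one]
      refine ContDiffOn.congr ?_ heq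
      refine ((contDiff_polyFn a M w).contDiffOn.sub (ContDiffOn.sum fun j hj => ?_)).mul
        (ContDiffOn.inv ((hq M).of_le (by exact_mod_cast le_top)).contDiffOn
          fun x hx => hqM x (hJ x hx))
      refine (contDiffOn_primIter (hmulc j) a Metric.isOpen_ball (hmul k j hk') (M - j)).of_le ?_
      have := Finset.mem_range.1 hj
      exact_mod_cast (by omega : k + 1 ≤ k + (M - j))
  refine ⟨hboot M le_rfl, fun x hx => ?_⟩
  have hnhds : Metric.ball a δ ∈ 𝓝 x := Metric.isOpen_ball.mem_nhds hx
  have hev : divInt M q a φ =ᶠ[𝓝 x] polyFn a M w := by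
    filter_upwards [hnhds] with y hy using h y (hJ y hy)
  -- The `M`-th derivative annihilates the polynomial and undoes the `M - j` primitives, leaving `j`
  -- derivatives of `q j * φ`.
  have h1 := hev.iteratedDeriv_eq M
  rw [iteratedDeriv_polyFn, divInt, iteratedDeriv_sum, Pi.zero_apply] at h1
  · rw [← h1]
    refine Finset.sum_congr rfl fun j hj => ?_
    have hjM : M - j + j = M := Nat.sub_add_cancel (Nat.lt_succ_iff.1 (Finset.mem_range.1 hj))
    rw [← iteratedDeriv_primIter (hmulc j) a (M - j) j, hjM]
  · intro j hj
    exact ((contDiffOn_primIter (hmulc j) a Metric.isOpen_ball (hmul M j (hboot M le_rfl))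
      (M - j)).contDiffAt hnhds).of_le (by exact_mod_cast Nat.le_add_right _ _)

/-! ### Parseval's identity on segments -/

section Weighted

variable {υ : ℝ → ℝ}

theorem isLocallyFiniteMeasure_weightMeasure (hc : Continuous υ) :
    IsLocallyFiniteMeasure (weightMeasure υ) :=
  IsLocallyFiniteMeasure.withDensity_ofReal hc

/-- Continuous functions that agree almost everywhere for a positive weight are equal. -/
theorem eq_of_ae_eq_weightMeasure (hc : Continuous υ) (hpos : ∀ x, 0 < υ x) {f g : ℝ → ℂ}
    (hf : Continuous f) (hg : Continuous g) (h : f =ᵐ[weightMeasure υ] g) : f = g := by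
  have hac : volume ≪ weightMeasure υ := withDensity_absolutelyContinuous'
    (ENNReal.continuous_ofReal.comp hc).aemeasurable (ae_of_all _ fun x => by simp [hpos x])
  exact (hf.ae_eq_iff_eq volume hg).1 (hac.ae_eq h)

theorem memLp_segment (hc : Continuous υ) {g : ℝ → ℂ} (hg : Continuous g) (s t : ℝ) :
    MemLp ((Set.Ioc s t).indicator g) 2 (weightMeasure υ) := by
  have := isLocallyFiniteMeasure_weightMeasure hc
  rw [memLp_indicator_iff_restrict measurableSet_Ioc]
  obtain ⟨C, hC⟩ := (isCompact_Icc (a := s) (b := t)).exists_bound_of_continuousOn hg.continuousOn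
  have : IsFiniteMeasure ((weightMeasure υ).restrict (Set.Ioc s t)) :=
    ⟨by rw [Measure.restrict_apply_univ]; exact measure_Ioc_lt_top⟩
  refine MemLp.of_bound hg.aestronglyMeasurable C ?_
  filter_upwards [ae_restrict_mem measurableSet_Ioc] with x hx using hC x (Set.Ioc_subset_Icc_self hx)

/-- The function `g` cut off to the segment `(s, t]`, as an element of `L²(ℝ, υ(x) dx)`. -/
def segment (hc : Continuous υ) {g : ℝ → ℂ} (hg : Continuous g) (s t : ℝ) : WeightedL2 υ :=
  (memLp_segment hc hg s t).toLp _

theorem inner_segment (hc : Continuous υ) (hpos : ∀ x, 0 < υ x) {g : ℝ → ℂ} (hg : Continuous g)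
    {s t : ℝ} (hst : s ≤ t) (w : WeightedL2 υ) {φ : ℝ → ℂ}
    (hφ : (w : ℝ → ℂ) =ᵐ[weightMeasure υ] φ) :
    inner ℂ (segment hc hg s t) w = ∫ x in s..t, starRingEnd ℂ (g x) * φ x * υ x := by
  rw [L2.inner_def, intervalIntegral.integral_of_le hst]
  have h1 : (fun x => inner ℂ ((segment hc hg s t : ℝ → ℂ) x) ((w : ℝ → ℂ) x))
      =ᵐ[weightMeasure υ] (Set.Ioc s t).indicator fun x => starRingEnd ℂ (g x) * φ x := by
    filter_upwards [hφ, (memLp_segment hc hg s t).coeFn_toLp] with x hx hx'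
    rw [hx, segment, hx']
    by_cases hxs : x ∈ Set.Ioc s t
    · simp [hxs, mul_comm]
    · simp [hxs]
  rw [integral_congr_ae h1, integral_indicator measurableSet_Ioc, weightMeasure,
    setIntegral_withDensity_eq_setIntegral_toReal_smul
      (f := fun x => ENNReal.ofReal (υ x)) hc.measurable.ennreal_ofReal (ae_of_all _ fun x => ENNReal.ofReal_lt_top)
      _ measurableSet_Ioc]
  refine integral_congr_ae (ae_of_all _ fun x => ?_)
  simp only [ENNReal.toReal_ofReal (hpos x).le, Complex.real_smul]
  ring

theorem norm_sq_segment (hc : Continuous υ) (hpos : ∀ x, 0 < υ x) {g : ℝ → ℂ} (hg : Continuous g)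
    {s t : ℝ} (hst : s ≤ t) :
    ‖segment hc hg s t‖ ^ 2 = ∫ x in s..t, ‖g x‖ ^ 2 * υ x := by
  have h1 := inner_segment hc hpos hg hst (segment hc hg s t) (memLp_segment hc hg s t).coeFn_toLp
  rw [inner_self_eq_norm_sq_to_K] at h1
  have h2 : ∫ x in s..t, starRingEnd ℂ (g x) * (Set.Ioc s t).indicator g x * υ x
      = ∫ x in s..t, ((‖g x‖ ^ 2 * υ x : ℝ) : ℂ) := by
    rw [intervalIntegral.integral_of_le hst, intervalIntegral.integral_of_le hst]
    refine setIntegral_congr_fun measurableSet_Ioc fun x hx => ?_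
    simp only [Set.indicator_of_mem hx, Complex.conj_mul']
    push_cast
    ring
  rw [h2, intervalIntegral.integral_ofReal] at h1
  refine Complex.ofReal_injective ?_
  rw [Complex.ofReal_pow]
  exact h1

/-- Parseval's identity for functions cut off to a segment. -/
theorem hasSum_segment (hc : Continuous υ) (hpos : ∀ x, 0 < υ x)
    (b : HilbertBasis ℕ ℂ (WeightedL2 υ)) {e : ℕ → ℝ → ℂ}
    (he : ∀ n, (b n : ℝ → ℂ) =ᵐ[weightMeasure υ] e n) {g : ℝ → ℂ} (hg : Continuous g)
    {s t : ℝ} (hst : s ≤ t) :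
    HasSum (fun n => ‖∫ x in s..t, starRingEnd ℂ (g x) * e n x * υ x‖ ^ 2)
      (∫ x in s..t, ‖g x‖ ^ 2 * υ x) := by
  have h := b.hasSum_inner_mul_inner (segment hc hg s t) (segment hc hg s t)
  rw [inner_self_eq_norm_sq_to_K] at h
  rw [← norm_sq_segment hc hpos hg hst]
  have h2 : ∀ n, inner ℂ (segment hc hg s t) (b n) * inner ℂ (b n) (segment hc hg s t)
      = ((‖∫ x in s..t, starRingEnd ℂ (g x) * e n x * υ x‖ ^ 2 : ℝ) : ℂ) := fun n => by
    rw [← inner_conj_symm (b n), Complex.mul_conj', inner_segment hc hpos hg hst _ (he n)]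
    push_cast
    rfl
  simp only [h2] at h
  refine Complex.hasSum_ofReal.1 ?_
  rw [Complex.ofReal_pow]
  exact h

end Weighted

/-- Parseval's identity for the system `e` and functions cut off to segments. -/
def SegmentParseval (υ : ℝ → ℝ) (e : ℕ → ℝ → ℂ) : Prop :=
  ∀ g : ℝ → ℂ, Continuous g → ∀ s t : ℝ, s ≤ t →
    HasSum (fun n => ‖∫ x in s..t, starRingEnd ℂ (g x) * e n x * υ x‖ ^ 2)
      (∫ x in s..t, ‖g x‖ ^ 2 * υ x)

/-- The members of a complete orthonormal system cannot be square-summably small on a segment. -/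
theorem SegmentParseval.not_small {υ : ℝ → ℝ} {e : ℕ → ℝ → ℂ} (hP : SegmentParseval υ e)
    (hc : Continuous υ) (hpos : ∀ x, 0 < υ x) {s t : ℝ} (hst : s < t) {κ : ℕ → ℝ}
    (hκ : Summable fun n => κ n ^ 2) (he : ∀ n, ∀ x ∈ Set.Icc s t, ‖e n x‖ ≤ κ n) : False := by
  set S := ∑' n, κ n ^ 2
  -- Parseval for the indicator of `(s, r]`, whose mass is `m`, gives `m ≤ S m²`. This fails once
  -- `r` is so close to `s` that `S m < 1`.
  have hlim : Tendsto (fun r => S * ∫ x in s..r, υ x) (𝓝[>] s) (𝓝 0) := by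
    have h1 : Continuous fun r => S * ∫ x in s..r, υ x := continuous_const.mul
      (intervalIntegral.continuous_primitive (fun a b => hc.intervalIntegrable a b) s)
    have h2 := h1.tendsto s
    simp only [intervalIntegral.integral_same, mul_zero] at h2
    exact h2.mono_left nhdsWithin_le_nhds
  obtain ⟨r, hr1, hr2⟩ := ((hlim.eventually_lt_const one_pos).and
    (Ioc_mem_nhdsGT hst)).exists
  have hm : 0 < ∫ x in s..r, υ x := intervalIntegral.intervalIntegral_pos_of_pos_on
    (hc.intervalIntegrable _ _) (fun x _ => hpos x) hr2.1
  set m := ∫ x in s..r, υ x with hmdef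
  have hsum := hP (fun _ => 1) continuous_const s r hr2.1.le
  simp only [map_one, one_mul, norm_one, one_pow] at hsum
  have hle : m ≤ S * m ^ 2 := by
    rw [← hmdef] at hsum
    refine hsum.tsum_eq.symm.trans_le ?_
    rw [← tsum_mul_right]
    refine hsum.summable.tsum_le_tsum (fun n => ?_) (hκ.mul_right _)
    rw [← mul_pow]
    refine pow_le_pow_left₀ (norm_nonneg _) ?_ 2
    rw [hmdef, ← intervalIntegral.integral_const_mul]
    refine intervalIntegral.norm_integral_le_of_norm_le hr2.1.le (ae_of_all _ fun x hx => ?_)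
      ((continuous_const.mul hc).intervalIntegrable _ _)
    rw [norm_mul, Complex.norm_real, Real.norm_of_nonneg (hpos x).le]
    exact mul_le_mul_of_nonneg_right (he n x ⟨hx.1.le, hx.2.trans hr2.2⟩) (hpos x).le
  nlinarith

/-! ### Modulus and phase of the eigenfunctions -/

theorem exp_mul_le_of_deriv_ge {G G' : ℝ → ℝ} {κ s t : ℝ} (hst : s ≤ t)
    (hG : ∀ x ∈ Set.Icc s t, HasDerivAt G (G' x) x) (h : ∀ x ∈ Set.Icc s t, κ * G x ≤ G' x) :
    G s * Real.exp (κ * (t - s)) ≤ G t := by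
  have hd : ∀ x ∈ Set.Icc s t, HasDerivAt (fun x => G x * Real.exp (-κ * x))
      ((G' x - κ * G x) * Real.exp (-κ * x)) x := fun x hx => by
    have h1 : HasDerivAt (fun x => Real.exp (-κ * x)) (Real.exp (-κ * x) * (-κ * 1)) x :=
      ((hasDerivAt_id x).const_mul (-κ)).exp
    exact ((hG x hx).mul h1).congr_deriv (by ring)
  have hmono : MonotoneOn (fun x => G x * Real.exp (-κ * x)) (Set.Icc s t) := by
    refine monotoneOn_of_deriv_nonneg (convex_Icc s t)
      (fun x hx => (hd x hx).continuousAt.continuousWithinAt)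
      (fun x hx => (hd x (interior_subset hx)).differentiableAt.differentiableWithinAt)
      fun x hx => ?_
    rw [(hd x (interior_subset hx)).deriv]
    exact mul_nonneg (sub_nonneg.2 (h x (interior_subset hx))) (Real.exp_pos _).le
  have h1 := hmono (Set.left_mem_Icc.2 hst) (Set.right_mem_Icc.2 hst) hst
  simp only at h1
  have h2 := mul_le_mul_of_nonneg_right h1 (Real.exp_pos (κ * t)).le
  rw [mul_assoc, mul_assoc, ← Real.exp_add, ← Real.exp_add] at h2
  rw [show -κ * s + κ * t = κ * (t - s) by ring, show -κ * t + κ * t = 0 by ring, Real.exp_zero,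
    mul_one] at h2
  exact h2

theorem le_exp_mul_of_deriv_le {G G' : ℝ → ℝ} {κ s t : ℝ} (hst : s ≤ t)
    (hG : ∀ x ∈ Set.Icc s t, HasDerivAt G (G' x) x) (h : ∀ x ∈ Set.Icc s t, G' x ≤ -κ * G x) :
    G t ≤ G s * Real.exp (-κ * (t - s)) := by
  have := exp_mul_le_of_deriv_ge (G := fun x => -G x) (G' := fun x => -G' x) (κ := -κ) hst
    (fun x hx => (hG x hx).neg) fun x hx => by have := h x hx; linarith
  linarith

theorem eq_of_hasDerivAt_zero {f : ℝ → ℂ} {s t : ℝ}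
    (h : ∀ x ∈ Set.uIcc s t, HasDerivAt f 0 x) : f t = f s := by
  have := intervalIntegral.integral_eq_sub_of_hasDerivAt h (by simp)
  rw [intervalIntegral.integral_zero] at this
  exact sub_eq_zero.1 this.symm

/-- The eigenfunctions of `n₁ d/dx + n₀` with eigenvalues `l n` of at least linear growth, forming
a complete orthonormal system for the weight `υ` and bounded by `A`. -/
structure EigenSystem (υ : ℝ → ℝ) (e : ℕ → ℝ → ℂ) (n₁ n₀ : ℝ → ℂ) (l : ℕ → ℝ) (A : ℝ → ℝ) :
    Prop where
  parseval : SegmentParseval υ e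
  cont_weight : Continuous υ
  weight_pos : ∀ x, 0 < υ x
  diff : ∀ n, Differentiable ℝ (e n)
  cont₁ : Continuous n₁
  cont₀ : Continuous n₀
  eigen : ∀ n x, n₁ x * deriv (e n) x + n₀ x * e n x = (l n : ℂ) * e n x
  growth : ∃ c > 0, ∀ᶠ n : ℕ in atTop, c * n ≤ |l n|
  cont_bound : Continuous A
  bound : ∀ n x, ‖e n x‖ ≤ A x

namespace EigenSystem

variable {υ : ℝ → ℝ} {e : ℕ → ℝ → ℂ} {n₁ n₀ : ℝ → ℂ} {l : ℕ → ℝ} {A : ℝ → ℝ}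

theorem hasDerivAt (h : EigenSystem υ e n₁ n₀ l A) (n : ℕ) {x : ℝ} (hx : n₁ x ≠ 0) :
    HasDerivAt (e n) ((l n - n₀ x) * (n₁ x)⁻¹ * e n x) x := by
  have h1 := h.eigen n x
  have h2 : deriv (e n) x = (l n - n₀ x) * (n₁ x)⁻¹ * e n x := by
    field_simp
    linear_combination h1
  rw [← h2]
  exact (h.diff n x).hasDerivAt

/-- Otherwise `|e n|²` would grow in one direction at a rate of order `|l n|` throughout a
neighbourhood of `y`. Being bounded by `A`, it would be exponentially small on a smaller segment,
contradicting `SegmentParseval.not_small`. -/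
theorem re_inv_eq_zero (h : EigenSystem υ e n₁ n₀ l A) {y : ℝ} (hy : n₁ y ≠ 0) :
    ((n₁ y)⁻¹).re = 0 := by
  by_contra hr
  set r := ((n₁ y)⁻¹).re with hrdef
  have hρ : ContinuousAt (fun x => (n₁ x)⁻¹) y := h.cont₁.continuousAt.inv₀ hy
  have hρre : ContinuousAt (fun x => r * ((n₁ x)⁻¹).re) y :=
    continuousAt_const.mul (Complex.continuous_re.continuousAt.comp hρ)
  have hD : ContinuousAt (fun x => |(n₀ x * (n₁ x)⁻¹).re|) y :=
    (Complex.continuous_re.continuousAt.comp (h.cont₀.continuousAt.mul hρ)).abs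
  have hr2 : 0 < r ^ 2 := by positivity
  set D := |(n₀ y * (n₁ y)⁻¹).re| + 1
  set A₀ := A y + 1
  have hev : ∀ᶠ x in 𝓝 y, n₁ x ≠ 0 ∧ r ^ 2 / 2 < r * ((n₁ x)⁻¹).re ∧
      |(n₀ x * (n₁ x)⁻¹).re| < D ∧ A x < A₀ := by
    refine (h.cont₁.continuousAt.eventually_ne hy).and ((hρre.eventually_const_lt ?_).and
      ((hD.eventually_lt_const (lt_add_one _)).and
        (h.cont_bound.continuousAt.eventually_lt_const (lt_add_one _))))
    change r ^ 2 / 2 < r * r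
    nlinarith
  obtain ⟨δ, hδ, hball⟩ := Metric.eventually_nhds_iff.1 hev
  obtain ⟨c, hc, hgr⟩ := h.growth
  have hloc : ∀ x, |x - y| < δ → n₁ x ≠ 0 ∧ r ^ 2 / 2 < r * ((n₁ x)⁻¹).re ∧
      |(n₀ x * (n₁ x)⁻¹).re| < D ∧ A x < A₀ := fun x hx => hball (by rwa [Real.dist_eq])
  have hr0 : 0 < |r| := abs_pos.2 hr
  have hG : ∀ n x, |x - y| < δ → HasDerivAt (fun x => ‖e n x‖ ^ 2)
      (2 * (l n * ((n₁ x)⁻¹).re - (n₀ x * (n₁ x)⁻¹).re) * ‖e n x‖ ^ 2) x := by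
    intro n x hx
    have h1 := (h.hasDerivAt n (hloc x hx).1).norm_sq
    refine h1.congr_deriv ?_
    have h2 : inner ℝ (e n x) ((l n - n₀ x) * (n₁ x)⁻¹ * e n x)
        = ((l n - n₀ x) * (n₁ x)⁻¹).re * ‖e n x‖ ^ 2 := by
      rw [Complex.inner, mul_assoc, Complex.mul_conj', ← Complex.ofReal_pow,
        Complex.re_mul_ofReal]
    rw [h2, sub_mul, Complex.sub_re, Complex.re_ofReal_mul]
    ring
  have hA₀ : ∀ n x, |x - y| < δ → ‖e n x‖ ^ 2 ≤ A₀ ^ 2 := fun n x hx =>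
    pow_le_pow_left₀ (norm_nonneg _) ((h.bound n x).trans (hloc x hx).2.2.2.le) 2
  have hsmall : ∀ n, ∀ x ∈ Set.Icc (y - δ / 4) (y + δ / 4),
      ‖e n x‖ ^ 2 ≤ A₀ ^ 2 * Real.exp (-(|l n| * |r| - 2 * D) * (δ / 4)) := by
    intro n x hx
    -- The sign of `l n * r` tells whether `|e n|²` grows to the right or to the left. In either
    -- case the bound by `A₀` at distance `δ / 4` in the direction of growth is carried back to `x`.
    rcases le_total 0 (l n * r) with hs | hs
    · have hin : ∀ z ∈ Set.Icc x (x + δ / 4), |z - y| < δ := fun z hz => by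
        rw [abs_lt]; constructor <;> linarith [hz.1, hz.2, hx.1, hx.2]
      have h1 := exp_mul_le_of_deriv_ge (κ := |l n| * |r| - 2 * D)
        (by linarith : x ≤ x + δ / 4) (fun z hz => hG n z (hin z hz)) fun z hz => by
          refine mul_le_mul_of_nonneg_right ?_ (sq_nonneg _)
          obtain ⟨_, h2, h3, _⟩ := hloc z (hin z hz)
          have h4 := (abs_lt.1 h3).2
          have h5 : |l n| * |r| * r ^ 2 ≤ 2 * (l n * ((n₁ z)⁻¹).re) * r ^ 2 := by
            rw [← abs_mul, abs_of_nonneg hs]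
            nlinarith
          have h6 := le_of_mul_le_mul_right h5 hr2
          linarith
      have h2 := hA₀ n _ (hin (x + δ / 4) ⟨by linarith, le_rfl⟩)
      have h3 := h1.trans h2
      rw [add_sub_cancel_left] at h3
      rw [neg_mul, Real.exp_neg, ← div_eq_mul_inv, le_div_iff₀ (Real.exp_pos _)]
      exact h3
    · have hin : ∀ z ∈ Set.Icc (x - δ / 4) x, |z - y| < δ := fun z hz => by
        rw [abs_lt]; constructor <;> linarith [hz.1, hz.2, hx.1, hx.2]
      have h1 := le_exp_mul_of_deriv_le (κ := |l n| * |r| - 2 * D)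
        (by linarith : x - δ / 4 ≤ x) (fun z hz => hG n z (hin z hz)) fun z hz => by
          refine mul_le_mul_of_nonneg_right ?_ (sq_nonneg _)
          obtain ⟨_, h2, h3, _⟩ := hloc z (hin z hz)
          have h4 := (abs_lt.1 h3).1
          have h5 : |l n| * |r| * r ^ 2 ≤ -(2 * (l n * ((n₁ z)⁻¹).re)) * r ^ 2 := by
            rw [← abs_mul, abs_of_nonpos hs]
            nlinarith
          have h6 := le_of_mul_le_mul_right h5 hr2
          linarith
      have h2 := hA₀ n _ (hin (x - δ / 4) ⟨le_rfl, by linarith⟩)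
      rw [sub_sub_cancel] at h1
      exact h1.trans (mul_le_mul_of_nonneg_right h2 (Real.exp_pos _).le)
  set κ : ℕ → ℝ := fun n => √(A₀ ^ 2 * Real.exp (-(|l n| * |r| - 2 * D) * (δ / 4)))
  have hκ : ∀ n, κ n ^ 2 = A₀ ^ 2 * Real.exp (-(|l n| * |r| - 2 * D) * (δ / 4)) := fun n =>
    Real.sq_sqrt (by positivity)
  refine h.parseval.not_small h.cont_weight h.weight_pos (s := y - δ / 4) (t := y + δ / 4)
    (by linarith) (κ := κ) ?_ fun n x hx => Real.le_sqrt_of_sq_le (hsmall n x hx)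
  simp only [hκ]
  have hgeo : Summable fun n : ℕ => A₀ ^ 2 * Real.exp (D * δ / 2)
      * Real.exp (n * (-(c * |r| * δ / 4))) := by
    refine (Real.summable_exp_nat_mul_iff.2 ?_).mul_left _
    have : 0 < c * |r| * δ / 4 := by positivity
    linarith
  refine Summable.of_norm_bounded_eventually_nat hgeo ?_
  filter_upwards [hgr] with n hn
  rw [Real.norm_of_nonneg (by positivity), mul_assoc, ← Real.exp_add]
  refine mul_le_mul_of_nonneg_left (Real.exp_le_exp.2 ?_) (sq_nonneg _)
  have : c * n * (|r| * δ / 4) ≤ |l n| * (|r| * δ / 4) := by gcongr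
  linarith

/-- If `n₁` is nonzero somewhere, the failure makes all `e n` vanish on a segment. If `n₁ = 0`
identically, then `n₀ = l n` wherever `e n ≠ 0`, so on `[0, 1]` all but finitely many `e n` vanish.
Both contradict completeness. -/
theorem exists_ne_zero (h : EigenSystem υ e n₁ n₀ l A) : ∃ k y, n₁ y ≠ 0 ∧ e k y ≠ 0 := by
  by_contra! hcon
  by_cases h1 : ∃ y, n₁ y ≠ 0
  · obtain ⟨y, hy⟩ := h1
    obtain ⟨δ, hδ, hball⟩ := Metric.eventually_nhds_iff.1 (h.cont₁.continuousAt.eventually_ne hy)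
    refine h.parseval.not_small h.cont_weight h.weight_pos (s := y) (t := y + δ / 2)
      (by linarith) (κ := 0) (by simp) fun n x hx => ?_
    have hx' : n₁ x ≠ 0 := hball (by
      rw [Real.dist_eq, abs_lt]; constructor <;> linarith [hx.1, hx.2])
    simp [hcon n x hx']
  · push Not at h1
    obtain ⟨D, hD⟩ := (isCompact_Icc (a := (0 : ℝ)) (b := 1)).exists_bound_of_continuousOn
      h.cont₀.continuousOn
    obtain ⟨B, hB⟩ := (isCompact_Icc (a := (0 : ℝ)) (b := 1)).exists_bound_of_continuousOn
      h.cont_bound.continuousOn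
    obtain ⟨c, hc, hgr⟩ := h.growth
    have hlarge : ∀ᶠ n : ℕ in atTop, D < |l n| := by
      have : Tendsto (fun n : ℕ => c * (n : ℝ)) atTop atTop :=
        tendsto_natCast_atTop_atTop.const_mul_atTop hc
      filter_upwards [hgr, this.eventually_gt_atTop D] with n h1 h2 using h2.trans_le h1
    obtain ⟨N, hN⟩ := eventually_atTop.1 hlarge
    refine h.parseval.not_small h.cont_weight h.weight_pos (s := 0) (t := 1)
      one_pos (κ := fun n => if n < N then B else 0) ?_ fun n x hx => ?_
    · refine summable_of_ne_finset_zero (s := Finset.range N) fun n hn => ?_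
      simp [Finset.mem_range.not.1 hn]
    · split_ifs with hn
      · exact (h.bound n x).trans ((le_abs_self _).trans (hB x hx))
      · have h2 := h.eigen n x
        rw [h1 x, zero_mul, zero_add] at h2
        have h3 : ‖n₀ x‖ < ‖(l n : ℂ)‖ := by
          rw [Complex.norm_real, Real.norm_eq_abs]
          exact (hD x hx).trans_lt (hN n (not_lt.1 hn))
        have h4 : e n x = 0 := by
          by_contra h5
          rw [mul_right_cancel₀ h5 h2] at h3
          exact lt_irrefl _ h3
        simp [h4]

end EigenSystem

/-- The modulus of `∫ exp(iμθ) θ'` over a segment depends only on the increment of `θ`. -/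
theorem norm_integral_exp_eq {θ τ : ℝ → ℝ} (hθ : ∀ x, HasDerivAt θ (τ x) x) (hτ : Continuous τ)
    (μ : ℝ) {s t s' t' : ℝ} (h : θ t - θ s = θ t' - θ s') :
    ‖∫ x in s..t, Complex.exp (Complex.I * μ * θ x) * τ x‖
      = ‖∫ x in s'..t', Complex.exp (Complex.I * μ * θ x) * τ x‖ := by
  have key : ∀ s t, ‖∫ x in s..t, Complex.exp (Complex.I * μ * θ x) * τ x‖
      = ‖∫ v in (0 : ℝ)..(θ t - θ s), Complex.exp (Complex.I * μ * v)‖ := by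
    intro s t
    have h1 : ∫ x in s..t, Complex.exp (Complex.I * μ * θ x) * τ x
        = ∫ v in θ s..θ t, Complex.exp (Complex.I * μ * v) := by
      have := intervalIntegral.integral_deriv_smul_comp (a := s) (b := t) (f := θ) (f' := τ)
        (g := fun v : ℝ => Complex.exp (Complex.I * μ * v)) (fun x _ => hθ x) hτ.continuousOn
        (by fun_prop)
      rw [← this]
      exact intervalIntegral.integral_congr fun x _ => by
        simp only [Function.comp_apply, Complex.real_smul]
        ring
    have h2 : ∫ v in θ s..θ t, Complex.exp (Complex.I * μ * v)
        = Complex.exp (((μ * θ s : ℝ) : ℂ) * Complex.I)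
          * ∫ v in (0 : ℝ)..(θ t - θ s), Complex.exp (Complex.I * μ * v) := by
      rw [← intervalIntegral.integral_const_mul]
      have := intervalIntegral.integral_comp_add_right (a := 0) (b := θ t - θ s)
        (fun v : ℝ => Complex.exp (Complex.I * μ * v)) (θ s)
      rw [zero_add, sub_add_cancel] at this
      rw [← this]
      refine intervalIntegral.integral_congr fun v _ => ?_
      rw [← Complex.exp_add]
      congr 1
      push_cast
      ring
    rw [h1, h2, norm_mul, Complex.norm_exp_ofReal_mul_I, one_mul]
  rw [key, key, h]

/-- If Parseval's identity for the functions `exp(iμθ)` holds with weight `R`, then `R` is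
constant. -/
theorem const_of_exp_parseval {θ τ R : ℝ → ℝ} (hθ : ∀ x, HasDerivAt θ (τ x) x)
    (hτ : Continuous τ) (hτ0 : ∀ x, 0 < τ x) (hR : Continuous R) (C : ℕ → ℝ) (μ : ℕ → ℝ)
    {y δ : ℝ} (h : ∀ s t, |s - y| ≤ δ → |t - y| ≤ δ → s ≤ t →
      HasSum (fun n => C n * ‖∫ x in s..t, Complex.exp (Complex.I * μ n * θ x) * τ x‖ ^ 2)
        (∫ x in s..t, R x * τ x)) :
    ∀ s s', |s - y| < δ → |s' - y| < δ → R s ≤ R s' := by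
  intro s s' hs hs'
  by_contra! hlt
  obtain ⟨m₁, hm₁, hlt'⟩ := exists_between hlt
  obtain ⟨m₂, hm₁₂, hm₂⟩ := exists_between hlt'
  have hθc : Continuous θ := continuous_iff_continuousAt.2 fun x => (hθ x).continuousAt
  have hmono : StrictMono θ := strictMono_of_deriv_pos fun x => by
    rw [(hθ x).deriv]; exact hτ0 x
  have hnear : ∀ s, |s - y| < δ → ∀ P : ℝ → Prop, (∀ᶠ x in 𝓝 s, P x) → ∃ η > 0,
      ∀ x ∈ Set.Icc s (s + η), P x ∧ |x - y| ≤ δ := by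
    intro s hs P hP
    have h2 : ∀ᶠ x in 𝓝 s, |x - y| < δ :=
      ((continuous_id.sub continuous_const).abs.continuousAt.eventually_lt_const hs)
    obtain ⟨ε, hε, hb⟩ := Metric.eventually_nhds_iff.1 (hP.and h2)
    refine ⟨ε / 2, by positivity, fun x hx => ?_⟩
    have := hb (y := x) (by rw [Real.dist_eq, abs_lt]; constructor <;> linarith [hx.1, hx.2])
    exact ⟨this.1, this.2.le⟩
  obtain ⟨η, hη, hI⟩ := hnear s hs _ (hR.continuousAt.eventually_const_lt hm₂)
  obtain ⟨η', hη', hI'⟩ := hnear s' hs' _ (hR.continuousAt.eventually_lt_const hm₁)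
  -- Segments from `s` and from `s'` with the same increment `d` of `θ` have equal Parseval sums,
  -- hence equal integrals of `R` against `dθ`; but one is at least `m₂ d` and the other at most `m₁
  -- d < m₂ d`.
  set d := min (θ (s + η) - θ s) (θ (s' + η') - θ s')
  have hd : 0 < d := lt_min (sub_pos.2 (hmono (by linarith))) (sub_pos.2 (hmono (by linarith)))
  obtain ⟨t, ht, hθt⟩ := intermediate_value_Icc (by linarith : s ≤ s + η) hθc.continuousOn
    (show θ s + d ∈ Set.Icc (θ s) (θ (s + η)) from
      ⟨by linarith, by linarith [min_le_left (θ (s + η) - θ s) (θ (s' + η') - θ s')]⟩)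
  obtain ⟨t', ht', hθt'⟩ := intermediate_value_Icc (by linarith : s' ≤ s' + η') hθc.continuousOn
    (show θ s' + d ∈ Set.Icc (θ s') (θ (s' + η')) from
      ⟨by linarith, by linarith [min_le_right (θ (s + η) - θ s) (θ (s' + η') - θ s')]⟩)
  have hsum := h s t hs.le (hI t ht).2 ht.1
  have hsum' := h s' t' hs'.le (hI' t' ht').2 ht'.1
  have hinc : θ t - θ s = θ t' - θ s' := by rw [hθt, hθt']; ring
  simp only [norm_integral_exp_eq hθ hτ _ hinc] at hsum
  have heq := hsum.unique hsum'
  have hint : ∀ s t, ∫ x in s..t, τ x = θ t - θ s := fun s t =>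
    intervalIntegral.integral_eq_sub_of_hasDerivAt (fun x _ => hθ x) (hτ.intervalIntegrable _ _)
  have h1 : m₂ * d ≤ ∫ x in s..t, R x * τ x := by
    have : m₂ * d = ∫ x in s..t, m₂ * τ x := by
      rw [intervalIntegral.integral_const_mul, hint, hθt]; ring
    rw [this]
    refine intervalIntegral.integral_mono_on ht.1
      ((continuous_const.mul hτ).intervalIntegrable _ _) ((hR.mul hτ).intervalIntegrable _ _)
      fun x hx => mul_le_mul_of_nonneg_right (hI x ⟨hx.1, hx.2.trans ht.2⟩).1.le (hτ0 x).le
  have h2 : ∫ x in s'..t', R x * τ x ≤ m₁ * d := by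
    have : m₁ * d = ∫ x in s'..t', m₁ * τ x := by
      rw [intervalIntegral.integral_const_mul, hint, hθt']; ring
    rw [this]
    refine intervalIntegral.integral_mono_on ht'.1
      ((hR.mul hτ).intervalIntegrable _ _) ((continuous_const.mul hτ).intervalIntegrable _ _)
      fun x hx => mul_le_mul_of_nonneg_right (hI' x ⟨hx.1, hx.2.trans ht'.2⟩).1.le (hτ0 x).le
  nlinarith

namespace EigenSystem

variable {υ : ℝ → ℝ} {e : ℕ → ℝ → ℂ} {n₁ n₀ : ℝ → ℂ} {l : ℕ → ℝ} {A : ℝ → ℝ}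

/-- Two eigenfunctions differ by a constant times an exponential of the phase `θ`. -/
theorem eq_mul_exp (h : EigenSystem υ e n₁ n₀ l A) (k n : ℕ) {θ : ℝ → ℝ} {y x : ℝ}
    (hθy : θ y = 0) (hne : ∀ z ∈ Set.uIcc y x, n₁ z ≠ 0 ∧ e k z ≠ 0)
    (hθ : ∀ z ∈ Set.uIcc y x, ∃ d, HasDerivAt θ d z ∧ (n₁ z)⁻¹ = Complex.I * d) :
    e n x = e n y / e k y * e k x * Complex.exp (Complex.I * (l n - l k : ℝ) * θ x) := by
  have hder : ∀ z ∈ Set.uIcc y x, HasDerivAt (fun z => e n z / e k z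
      * Complex.exp (-(Complex.I * (l n - l k : ℝ) * θ z))) 0 z := by
    intro z hz
    obtain ⟨d, hd, hd'⟩ := hθ z hz
    obtain ⟨h1, h2⟩ := hne z hz
    have h3 : HasDerivAt (fun z => Complex.exp (-(Complex.I * (l n - l k : ℝ) * θ z)))
        (Complex.exp (-(Complex.I * (l n - l k : ℝ) * θ z))
          * -(Complex.I * (l n - l k : ℝ) * d)) z :=
      (hd.ofReal_comp.const_mul _).neg.cexp
    refine (((h.hasDerivAt n h1).div (h.hasDerivAt k h1) h2).mul h3).congr_deriv ?_
    rw [hd', Pi.div_apply]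
    field_simp
    push_cast
    ring
  have h1 := eq_of_hasDerivAt_zero hder
  simp only [hθy, Complex.ofReal_zero, mul_zero, neg_zero, Complex.exp_zero, mul_one] at h1
  have h2 := (hne x Set.right_mem_uIcc).2
  rw [← h1, Complex.exp_neg]
  have := Complex.exp_ne_zero (Complex.I * (l n - l k : ℝ) * θ x)
  field_simp

/-- Dividing by `e k` turns the Parseval identity into one for the functions `exp(iμθ)` with weight
`R = τ / (|e k|² υ)`, which `const_of_exp_parseval` shows to be constant. Since `n₁⁻¹ = iστ` near
`y`, the asserted quantity is `(iσR)⁻¹`. -/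
theorem locally_const (h : EigenSystem υ e n₁ n₀ l A) (k : ℕ) {y : ℝ} (hy : n₁ y ≠ 0)
    (hk : e k y ≠ 0) :
    ∀ᶠ x in 𝓝 y, (‖e k x‖ ^ 2 * υ x : ℝ) * n₁ x = (‖e k y‖ ^ 2 * υ y : ℝ) * n₁ y := by
  have hek : Continuous (e k) := (h.diff k).continuous
  have him0 : ((n₁ y)⁻¹).im ≠ 0 := fun h0 => by
    have := Complex.ext (z := (n₁ y)⁻¹) (w := 0) (h.re_inv_eq_zero hy) h0
    exact hy (inv_eq_zero.1 this)
  -- The sign `σ` makes the phase increasing.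
  obtain ⟨σ, hσ, hσ0⟩ : ∃ σ : ℝ, σ * σ = 1 ∧ 0 < σ * ((n₁ y)⁻¹).im := by
    rcases him0.lt_or_gt with h0 | h0
    · exact ⟨-1, by norm_num, by linarith⟩
    · exact ⟨1, by norm_num, by linarith⟩
  have hρ : ContinuousAt (fun x => σ * ((n₁ x)⁻¹).im) y :=
    continuousAt_const.mul (Complex.continuous_im.continuousAt.comp (h.cont₁.continuousAt.inv₀ hy))
  obtain ⟨ε, hε, hball⟩ := Metric.eventually_nhds_iff.1
    (((h.cont₁.continuousAt.eventually_ne hy).and (hek.continuousAt.eventually_ne hk)).and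
      (hρ.eventually_const_lt hσ0))
  set δ := ε / 2 with hδdef
  have hδ : 0 < δ := by positivity
  have hloc : ∀ x, |x - y| ≤ δ → n₁ x ≠ 0 ∧ e k x ≠ 0 ∧ 0 < σ * ((n₁ x)⁻¹).im := fun x hx => by
    have := hball (y := x) (by rw [Real.dist_eq]; linarith)
    exact ⟨this.1.1, this.1.2, this.2⟩
  have hle : y - δ ≤ y + δ := by linarith
  -- Composition with the projection onto `[y - δ, y + δ]` extends the local data to the line,
  -- keeping continuity and nonvanishing.
  set π : ℝ → ℝ := fun x => (Set.projIcc (y - δ) (y + δ) hle x : ℝ) with hπ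
  have hπc : Continuous π := continuous_subtype_val.comp continuous_projIcc
  have hπm : ∀ x, |π x - y| ≤ δ := fun x => by
    have := (Set.projIcc (y - δ) (y + δ) hle x).2
    rw [abs_le]
    constructor <;> linarith [this.1, this.2]
  have hπe : ∀ x, |x - y| ≤ δ → π x = x := fun x hx => by
    have h1 := abs_le.1 hx
    simp only [hπ]
    rw [Set.projIcc_of_mem hle (show x ∈ Set.Icc (y - δ) (y + δ) from
      ⟨by linarith [h1.1], by linarith [h1.2]⟩)]
  set τ : ℝ → ℝ := fun x => σ * ((n₁ (π x))⁻¹).im with hτ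
  have hτc : Continuous τ := continuous_const.mul (Complex.continuous_im.comp
    ((h.cont₁.comp hπc).inv₀ fun x => (hloc _ (hπm x)).1))
  have hτ0 : ∀ x, 0 < τ x := fun x => (hloc _ (hπm x)).2.2
  have hinv : ∀ x, |x - y| ≤ δ → (n₁ x)⁻¹ = Complex.I * (σ * τ x : ℝ) := by
    intro x hx
    have h1 : σ * τ x = ((n₁ x)⁻¹).im := by
      simp only [hτ, hπe x hx]
      rw [← mul_assoc, hσ, one_mul]
    rw [h1]
    apply Complex.ext
    · simpa using h.re_inv_eq_zero (hloc x hx).1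
    · simp
  set θ : ℝ → ℝ := fun x => ∫ t in y..x, τ t with hθ
  have hθd : ∀ x, HasDerivAt θ (τ x) x := fun x =>
    intervalIntegral.integral_hasDerivAt_right (hτc.intervalIntegrable _ _)
      (hτc.stronglyMeasurableAtFilter _ _) hτc.continuousAt
  set R : ℝ → ℝ := fun x => τ x / (‖e k (π x)‖ ^ 2 * υ x) with hR
  have hden : ∀ x, 0 < ‖e k (π x)‖ ^ 2 * υ x := fun x =>
    mul_pos (pow_pos (norm_pos_iff.2 (hloc _ (hπm x)).2.1) 2) (h.weight_pos x)
  have hekπ : Continuous fun x => e k (π x) := hek.comp hπc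
  have hRc : Continuous R :=
    hτc.div ((hekπ.norm.pow 2).mul h.cont_weight) fun x => (hden x).ne'
  have hsub : ∀ x, |x - y| ≤ δ → ∀ z ∈ Set.uIcc y x, |z - y| ≤ δ := fun x hx z hz =>
    (Set.abs_sub_left_of_mem_uIcc hz).trans hx
  have hrep : ∀ n x, |x - y| ≤ δ → e n x = e n y / e k y * e k x
      * Complex.exp (Complex.I * (l n - l k : ℝ) * (σ * θ x : ℝ)) := fun n x hx =>
    h.eq_mul_exp k n (θ := fun x => σ * θ x) (y := y) (by simp [hθ])
      (fun z hz => ⟨(hloc z (hsub x hx z hz)).1, (hloc z (hsub x hx z hz)).2.1⟩)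
      fun z hz => ⟨σ * τ z, (hθd z).const_mul σ, hinv z (hsub x hx z hz)⟩
  have hpars : ∀ s t, |s - y| ≤ δ → |t - y| ≤ δ → s ≤ t →
      HasSum (fun n => ‖e n y / e k y‖ ^ 2 * ‖∫ x in s..t,
        Complex.exp (Complex.I * ((l n - l k) * σ : ℝ) * θ x) * τ x‖ ^ 2)
        (∫ x in s..t, R x * τ x) := by
    intro s t hs ht hst
    have hin : ∀ x ∈ Set.uIcc s t, |x - y| ≤ δ := fun x hx => by
      rw [Set.uIcc_of_le hst] at hx
      have h1 := abs_le.1 hs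
      have h2 := abs_le.1 ht
      exact abs_le.2 ⟨by linarith [hx.1], by linarith [hx.2]⟩
    -- For this test function `g`, `conj g * e n * υ` is `τ * e n / e k`, a constant times `exp(iμθ)
    -- τ`, and `|g|² υ = R τ`.
    have hgc : Continuous fun x => (τ x : ℂ) / (starRingEnd ℂ (e k (π x)) * υ x) := by
      refine (Complex.continuous_ofReal.comp hτc).div ((Complex.continuous_conj.comp hekπ).mul
        (Complex.continuous_ofReal.comp h.cont_weight)) fun x => ?_
      have h1 := (hloc _ (hπm x)).2.1
      have h2 := (h.weight_pos x).ne'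
      simp [h1, h2]
    have hsum := h.parseval _ hgc s t hst
    have e1 : ∀ n, ‖∫ x in s..t, starRingEnd ℂ ((τ x : ℂ) / (starRingEnd ℂ (e k (π x)) * υ x))
        * e n x * υ x‖ ^ 2 = ‖e n y / e k y‖ ^ 2 * ‖∫ x in s..t,
        Complex.exp (Complex.I * ((l n - l k) * σ : ℝ) * θ x) * τ x‖ ^ 2 := by
      intro n
      rw [← mul_pow, ← norm_mul, ← intervalIntegral.integral_const_mul]
      congr 2
      refine intervalIntegral.integral_congr fun x hx => ?_
      have hx' := hin x hx
      have h1 := (hloc x hx').2.1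
      have h2 : (υ x : ℂ) ≠ 0 := by exact_mod_cast (h.weight_pos x).ne'
      have h3 : Complex.I * (l n - l k : ℝ) * (σ * θ x : ℝ)
          = Complex.I * ((l n - l k) * σ : ℝ) * θ x := by push_cast; ring
      simp only [map_div₀, map_mul, Complex.conj_conj, Complex.conj_ofReal]
      rw [hπe x hx', hrep n x hx', h3]
      field_simp
    have e2 : ∫ x in s..t, ‖(τ x : ℂ) / (starRingEnd ℂ (e k (π x)) * υ x)‖ ^ 2 * υ x
        = ∫ x in s..t, R x * τ x := by
      refine intervalIntegral.integral_congr fun x _ => ?_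
      have h1 : ‖e k (π x)‖ ≠ 0 := norm_ne_zero_iff.2 (hloc _ (hπm x)).2.1
      have h2 := (h.weight_pos x).ne'
      simp only [hR, norm_div, norm_mul, Complex.norm_real, Real.norm_eq_abs, div_pow, mul_pow,
        sq_abs, RCLike.norm_conj]
      field_simp
    simp only [e1] at hsum
    rwa [e2] at hsum
  have hconst := const_of_exp_parseval hθd hτc hτ0 hRc (fun n => ‖e n y / e k y‖ ^ 2)
    (fun n => (l n - l k) * σ) hpars
  have hF : ∀ x, |x - y| ≤ δ →
      (‖e k x‖ ^ 2 * υ x : ℝ) * n₁ x = (Complex.I * (σ * R x : ℝ))⁻¹ := by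
    intro x hx
    have h1 : n₁ x = (Complex.I * (σ * τ x : ℝ))⁻¹ := by rw [← hinv x hx, inv_inv]
    have h2 : ((‖e k x‖ ^ 2 * υ x : ℝ) : ℂ) ≠ 0 := by
      have := hden x
      rw [hπe x hx] at this
      exact_mod_cast this.ne'
    rw [h1]
    simp only [hR, hπe x hx]
    rw [← inv_inv ((‖e k x‖ ^ 2 * υ x : ℝ) : ℂ), ← mul_inv, ← Complex.ofReal_inv]
    congr 1
    push_cast
    ring
  filter_upwards [Metric.ball_mem_nhds y hδ] with x hx
  rw [Metric.mem_ball, Real.dist_eq] at hx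
  have hy0 : |y - y| < δ := by simpa using hδ
  rw [hF x hx.le, hF y hy0.le, le_antisymm (hconst x y hx hy0) (hconst y x hy0 hx)]

/-- A level set of `|e k|² υ n₁` at a nonzero value contains no zero of `n₁` or `e k`, so
`locally_const` applies at each of its points and makes it open. It is also closed, hence the whole
line. In particular `n₁` and `e k` never vanish. -/
theorem exists_const (h : EigenSystem υ e n₁ n₀ l A) :
    ∃ (k : ℕ) (c : ℂ), c ≠ 0 ∧ ∀ x, (‖e k x‖ ^ 2 * υ x : ℝ) * n₁ x = c := by
  obtain ⟨k, y, hy, hk⟩ := h.exists_ne_zero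
  set F : ℝ → ℂ := fun x => (‖e k x‖ ^ 2 * υ x : ℝ) * n₁ x with hF
  have hFc : Continuous F := (Complex.continuous_ofReal.comp
    (((h.diff k).continuous.norm.pow 2).mul h.cont_weight)).mul h.cont₁
  have hF0 : ∀ x, F x ≠ 0 ↔ n₁ x ≠ 0 ∧ e k x ≠ 0 := fun x => by
    have := (h.weight_pos x).ne'
    simp only [hF, ne_eq, mul_eq_zero, Complex.ofReal_eq_zero, this, or_false, norm_eq_zero,
      pow_eq_zero_iff, OfNat.ofNat_ne_zero, not_false_eq_true]
    tauto
  have hFy := (hF0 y).2 ⟨hy, hk⟩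
  have hclopen : IsClopen (F ⁻¹' {F y}) := by
    refine ⟨isClosed_singleton.preimage hFc, isOpen_iff_mem_nhds.2 fun x hx => ?_⟩
    have hx' : F x = F y := hx
    obtain ⟨h1, h2⟩ := (hF0 x).1 (hx' ▸ hFy)
    filter_upwards [h.locally_const k h1 h2] with z hz
    exact Set.mem_preimage.2 (Set.mem_singleton_iff.2 (Eq.trans hz hx'))
  have huniv := hclopen.eq_univ ⟨y, rfl⟩
  exact ⟨k, F y, hFy, fun x => by
    have : x ∈ F ⁻¹' {F y} := huniv ▸ Set.mem_univ x
    exact this⟩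

/-- The structure theorem: the eigenfunctions are constant multiples of `g exp(i(λ_n - λ_k)θ)`
where `g` and the phase `θ` are as regular as the data allow. -/
theorem exists_phase (h : EigenSystem υ e n₁ n₀ l A) {M : ℕ} (he : ∀ n, ContDiff ℝ M (e n))
    (hυ : ContDiff ℝ M υ) :
    ∃ (k : ℕ) (θ : ℝ → ℝ) (c : ℕ → ℂ) (K : ℝ), ContDiff ℝ (M + 1 : ℕ) θ ∧
      (∀ x, deriv θ x ≠ 0) ∧ (∀ n, ‖c n‖ ≤ K) ∧
      ∀ n x, e n x = c n * (e k x * Complex.exp (Complex.I * (l n - l k : ℝ) * θ x)) := by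
  obtain ⟨k, F, hF0, hF⟩ := h.exists_const
  have hne : ∀ x, n₁ x ≠ 0 ∧ e k x ≠ 0 := fun x => by
    have h1 := hF0
    rw [← hF x] at h1
    refine ⟨right_ne_zero_of_mul h1, fun h2 => h1 ?_⟩
    simp [h2]
  -- Expressing `n₁⁻¹` through `e k` and `υ` shows that it is `C^M`, one class better than assumed
  -- of `n₁`.
  set τ : ℝ → ℝ := fun x => ‖e k x‖ ^ 2 * υ x * (F⁻¹).im with hτ
  have hinv : ∀ x, (n₁ x)⁻¹ = Complex.I * (τ x : ℝ) := by
    intro x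
    have h1 : (n₁ x)⁻¹ = (‖e k x‖ ^ 2 * υ x : ℝ) * F⁻¹ := by
      rw [eq_mul_inv_iff_mul_eq₀ hF0, ← hF x]
      field_simp [(hne x).1]
    apply Complex.ext
    · rw [h.re_inv_eq_zero (hne x).1]
      simp
    · rw [h1, Complex.im_ofReal_mul, Complex.I_mul_im, Complex.ofReal_re]
  have hτM : ContDiff ℝ M τ := (((he k).norm_sq ℝ).mul hυ).mul contDiff_const
  have hτc : Continuous τ := hτM.continuous
  set θ : ℝ → ℝ := fun x => ∫ t in (0 : ℝ)..x, τ t with hθ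
  have hθd : ∀ x, HasDerivAt θ (τ x) x := fun x =>
    intervalIntegral.integral_hasDerivAt_right (hτc.intervalIntegrable _ _)
      (hτc.stronglyMeasurableAtFilter _ _) hτc.continuousAt
  have hdθ : deriv θ = τ := funext fun x => (hθd x).deriv
  refine ⟨k, θ, fun n => e n 0 / e k 0, A 0 / ‖e k 0‖, ?_, fun x hx => ?_, fun n => ?_,
    fun n x => ?_⟩
  · rw [Nat.cast_add, Nat.cast_one, contDiff_succ_iff_deriv, hdθ]
    exact ⟨fun x => (hθd x).differentiableAt, by simp, hτM⟩
  · have h1 := hinv x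
    rw [hdθ] at hx
    rw [hx, Complex.ofReal_zero, mul_zero] at h1
    exact (hne x).1 (inv_eq_zero.1 h1)
  · rw [norm_div]
    exact div_le_div_of_nonneg_right (h.bound n 0) (norm_nonneg _)
  · rw [← mul_assoc]
    exact h.eq_mul_exp k n (by simp [hθ]) (fun z _ => hne z) fun z _ => ⟨τ z, hθd z, hinv z⟩

end EigenSystem

/-! ### From convergence in `H` to weak convergence, and the action of `B` on the basis -/

/-- Closed graph theorem: an `L²`-convergent sequence has an almost everywhere convergent
subsequence, whose limit `limit_unique` identifies. -/
theorem FunctionSpaceIn.continuous_toFn {H : Type*} [NormedAddCommGroup H]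
    [InnerProductSpace ℂ H] [CompleteSpace H] {υ : ℝ → ℝ} (S : FunctionSpaceIn H υ) :
    Continuous S.toFn := by
  refine S.toFn.continuous_of_seq_closed_graph fun u x y hu hy => ?_
  obtain ⟨ns, hns, hae⟩ := (tendstoInMeasure_of_tendsto_Lp hy).exists_seq_tendsto_ae
  have h := S.limit_unique (u ∘ ns) x y (hu.comp hns.tendsto_atTop) hae
  exact (Lp.ext h).symm

/-- Integrals of a function over short segments are controlled by its weighted `L²` norm. -/
theorem exists_norm_prim_le {υ : ℝ → ℝ} (hc : Continuous υ) (hpos : ∀ x, 0 < υ x) {g : ℝ → ℂ}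
    (hg : Continuous g) (a : ℝ) (δ : ℝ) :
    ∃ C, 0 ≤ C ∧ ∀ (w : WeightedL2 υ) (φ : ℝ → ℂ), (w : ℝ → ℂ) =ᵐ[weightMeasure υ] φ →
      ∀ x, |x - a| ≤ δ → ‖prim a (g * φ) x‖ ≤ C * ‖w‖ := by
  -- Pairing with `conj (g / υ)` on a segment cancels the weight and yields `∫ g φ`; Cauchy–Schwarz
  -- does the rest.
  have hGc : Continuous fun x => starRingEnd ℂ (g x / υ x) :=
    Complex.continuous_conj.comp (hg.div (Complex.continuous_ofReal.comp hc)
      fun x => by exact_mod_cast (hpos x).ne')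
  have hsqc : Continuous fun x => ‖starRingEnd ℂ (g x / υ x)‖ ^ 2 * υ x := (hGc.norm.pow 2).mul hc
  have hsq0 : ∀ x, 0 ≤ ‖starRingEnd ℂ (g x / υ x)‖ ^ 2 * υ x := fun x =>
    mul_nonneg (sq_nonneg _) (hpos x).le
  have hseg : ∀ s t, a - δ ≤ s → s ≤ t → t ≤ a + δ → ‖segment hc hGc s t‖
      ≤ √(∫ x in (a - δ)..(a + δ), ‖starRingEnd ℂ (g x / υ x)‖ ^ 2 * υ x) := by
    intro s t hs hst ht
    refine Real.le_sqrt_of_sq_le ?_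
    rw [norm_sq_segment hc hpos hGc hst]
    exact intervalIntegral.integral_mono_interval hs hst ht (ae_of_all _ hsq0)
      (hsqc.intervalIntegrable _ _)
  refine ⟨√(∫ x in (a - δ)..(a + δ), ‖starRingEnd ℂ (g x / υ x)‖ ^ 2 * υ x),
    Real.sqrt_nonneg _, fun w φ hw x hx => ?_⟩
  have hval : ∀ s t, s ≤ t → ∫ y in s..t, g y * φ y = inner ℂ (segment hc hGc s t) w := by
    intro s t hst
    rw [inner_segment hc hpos hGc hst w hw]
    refine intervalIntegral.integral_congr fun y _ => ?_
    have : (υ y : ℂ) ≠ 0 := by exact_mod_cast (hpos y).ne'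
    simp only [Complex.conj_conj]
    field_simp
  obtain ⟨h1, h2⟩ := abs_le.1 hx
  change ‖∫ y in a..x, g y * φ y‖ ≤ _
  rcases le_total a x with h | h
  · rw [hval a x h]
    exact (norm_inner_le_norm _ _).trans
      (mul_le_mul_of_nonneg_right (hseg a x (by linarith) h (by linarith)) (norm_nonneg _))
  · rw [intervalIntegral.integral_symm, norm_neg, hval x a h]
    exact (norm_inner_le_norm _ _).trans
      (mul_le_mul_of_nonneg_right (hseg x a (by linarith) h (by linarith)) (norm_nonneg _))

theorem continuous_shiftedOp {M : ℕ} {p : ℕ → ℝ → ℂ} (hp : ∀ m ≤ M, ContDiff ℝ ∞ (p m)) (lam : ℂ)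
    {φ : ℝ → ℂ} (hφ : ContDiff ℝ M φ) : Continuous (shiftedOp M p lam φ) := by
  unfold shiftedOp diffOp
  refine (continuous_finsetSum _ fun m hm => ?_).sub (continuous_const.mul hφ.continuous)
  have hm' : m ≤ M := Nat.lt_succ_iff.1 (Finset.mem_range.1 hm)
  exact (hp m hm').continuous.mul (hφ.continuous_iteratedDeriv m (by exact_mod_cast hm'))

theorem shiftedOp_add {M : ℕ} {p : ℕ → ℝ → ℂ} {lam : ℂ} {φ ψ : ℝ → ℂ}
    (hφ : ContDiff ℝ M φ) (hψ : ContDiff ℝ M ψ) (x : ℝ) :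
    shiftedOp M p lam (φ + ψ) x = shiftedOp M p lam φ x + shiftedOp M p lam ψ x := by
  simp only [shiftedOp, diffOp_add hφ hψ, Pi.add_apply]
  ring

theorem shiftedOp_smul {M : ℕ} {p : ℕ → ℝ → ℂ} {lam : ℂ} (c : ℂ) (φ : ℝ → ℂ) (x : ℝ) :
    shiftedOp M p lam (c • φ) x = c * shiftedOp M p lam φ x := by
  simp only [shiftedOp, diffOp_smul, Pi.smul_apply, smul_eq_mul]
  ring

theorem shiftedOp_sum {M : ℕ} {p : ℕ → ℝ → ℂ} {lam : ℂ} (s : Finset ℕ) (c : ℕ → ℂ)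
    {e : ℕ → ℝ → ℂ} (he : ∀ n, ContDiff ℝ M (e n)) (x : ℝ) :
    ContDiff ℝ M (∑ n ∈ s, c n • e n) ∧ shiftedOp M p lam (∑ n ∈ s, c n • e n) x
      = ∑ n ∈ s, c n * shiftedOp M p lam (e n) x := by
  classical
  induction s using Finset.induction_on with
  | empty => exact ⟨contDiff_const, by simp [shiftedOp, diffOp_zero]⟩
  | insert i s hi ih =>
    have h1 : ContDiff ℝ M (c i • e i) := (he i).const_smul (c i)
    rw [Finset.sum_insert hi, Finset.sum_insert hi, shiftedOp_add h1 ih.1, ih.2, shiftedOp_smul]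
    exact ⟨h1.add ih.1, rfl⟩

namespace Quintuplet

variable {H : Type*} [NormedAddCommGroup H] [InnerProductSpace ℂ H] (Q : Quintuplet H)

theorem exists_eigenSystem (hM : 1 ≤ Q.M) (h2p : Q.C2Plus) (h22 : Q.C2_2) (h23 : Q.C2_3) :
    ∃ n₁ n₀ l A, EigenSystem Q.υ Q.eD n₁ n₀ l A := by
  obtain ⟨heD, n₁, n₀, hn₁, hn₀, l, heig, hlim⟩ := h22
  obtain ⟨A, hA, hbd⟩ := h23
  have hM0 : ((Q.M : ℕ) : WithTop ℕ∞) ≠ 0 := by exact_mod_cast (by omega : Q.M ≠ 0)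
  refine ⟨n₁, n₀, l, A, ⟨fun g hg s t hst => hasSum_segment h2p.2.continuous h2p.1 Q.basisD
    Q.basisD_eq hg hst, h2p.2.continuous, h2p.1, fun n => (heD n).differentiable hM0,
    hn₁.continuous, hn₀.continuous, heig, ?_, hA, hbd⟩⟩
  obtain ⟨c, hc0, hc⟩ := EReal.lt_iff_exists_real_btwn.1 hlim
  refine ⟨c, by exact_mod_cast hc0, ?_⟩
  filter_upwards [eventually_lt_of_lt_liminf hc, eventually_gt_atTop 0] with n hn hn0
  have h1 : c < |l n| / n := by exact_mod_cast hn
  have h2 : (0 : ℝ) < n := by exact_mod_cast hn0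
  exact ((lt_div_iff₀ h2).1 h1).le

variable {Q}

/-- On the basis, `B` acts as the differential operator. -/
theorem B_basis (h1 : Q.C1) (h2p : Q.C2Plus) (n : ℕ) :
    (Q.B ⟨Q.basis n, h1.mem_domain n⟩ : ℝ → ℂ) =ᵐ[weightMeasure Q.υ]
      shiftedOp Q.M Q.p Q.lam (Q.e n) := by
  have hunique : ∀ f g : ℝ → ℂ, Continuous f → Continuous g → f =ᵐ[weightMeasure Q.υ] g → f = g :=
    fun f g hf hg h => eq_of_ae_eq_weightMeasure h2p.2.continuous h2p.1 hf hg h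
  -- `toLinearPMap` has the given graph only if that submodule is single-valued. It is, because
  -- continuous representatives are unique for a positive weight.
  have hgraph : ∀ q : H × WeightedL2 Q.υ, q ∈ Q.graphBt → q.1 = 0 → q.2 = 0 := by
    rintro q ⟨φ, hφ, hq1, hq2⟩ hq0
    rw [hq0, map_zero] at hq1
    have h0 : φ = 0 := hunique φ 0 hφ.continuous continuous_const
      (hq1.symm.trans (Lp.coeFn_zero _ _ _))
    rw [h0] at hq2
    have hz : shiftedOp Q.M Q.p Q.lam 0 = 0 := by
      ext x
      simp [shiftedOp, diffOp_zero]
    rw [hz] at hq2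
    exact Lp.eq_zero_iff_ae_eq_zero.2 hq2
  have hB : Q.B ⟨Q.basis n, h1.mem_domain n⟩ = Q.Bt ⟨Q.basis n, (h1 n).2⟩ :=
    (Q.Bt.le_closure.2 (x := ⟨Q.basis n, (h1 n).2⟩) (y := ⟨Q.basis n, h1.mem_domain n⟩) rfl).symm
  obtain ⟨φ, hφ, hq1, hq2⟩ := Submodule.mem_graph_toLinearPMap (g := Q.graphBt) hgraph
    ⟨Q.basis n, (h1 n).2⟩
  have hφe : φ = Q.e n := hunique φ _ hφ.continuous (h1 n).1.continuous
    (hq1.symm.trans (Q.basis_eq n))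
  rw [hφe] at hq2
  rw [hB]
  exact hq2

/-- The image of a basis function is a finite combination of the `e◇`, pointwise. -/
theorem shiftedOp_basis (hp : ∀ m ≤ Q.M, ContDiff ℝ ∞ (Q.p m)) (h1 : Q.C1) (h2p : Q.C2Plus)
    (heD : ∀ n, Continuous (Q.eD n)) (n : ℕ) (s : Finset ℕ) (hs : ∀ m, m ∉ s → Q.b h1 m n = 0)
    (x : ℝ) :
    shiftedOp Q.M Q.p Q.lam (Q.e n) x = ∑ m ∈ s, Q.b h1 m n * Q.eD m x := by
  have hsum := Q.basisD.hasSum_repr (Q.B ⟨Q.basis n, h1.mem_domain n⟩)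
  simp only [HilbertBasis.repr_apply_apply] at hsum
  have hfin : HasSum (fun m => Q.b h1 m n • Q.basisD m) (∑ m ∈ s, Q.b h1 m n • Q.basisD m) :=
    hasSum_sum_of_ne_finset_zero fun m hm => by rw [hs m hm, zero_smul]
  have hB : Q.B ⟨Q.basis n, h1.mem_domain n⟩ = ∑ m ∈ s, Q.b h1 m n • Q.basisD m :=
    hsum.unique hfin
  have hae : ∀ t : Finset ℕ, ((∑ m ∈ t, Q.b h1 m n • Q.basisD m : WeightedL2 Q.υ) : ℝ → ℂ)
      =ᵐ[weightMeasure Q.υ] fun x => ∑ m ∈ t, Q.b h1 m n * Q.eD m x := by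
    classical
    intro t
    induction t using Finset.induction_on with
    | empty =>
      simp only [Finset.sum_empty]
      exact Lp.coeFn_zero ℂ 2 (weightMeasure Q.υ)
    | insert i t hi ih =>
      rw [Finset.sum_insert hi]
      filter_upwards [Lp.coeFn_add (Q.b h1 i n • Q.basisD i) (∑ m ∈ t, Q.b h1 m n • Q.basisD m),
        Lp.coeFn_smul (Q.b h1 i n) (Q.basisD i), ih, Q.basisD_eq i] with x hx1 hx2 hx3 hx4
      rw [hx1, Pi.add_apply, hx2, Pi.smul_apply, hx3, hx4, Finset.sum_insert hi, smul_eq_mul]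
  have h := B_basis h1 h2p n
  rw [hB] at h
  refine congrFun (eq_of_ae_eq_weightMeasure h2p.2.continuous h2p.1
    (continuous_shiftedOp hp Q.lam (h1 n).1)
    (continuous_finsetSum s fun m _ => continuous_const.mul (heD m)) (h.symm.trans (hae s))) x

/-- The partial sums of a square-summable expansion are weakly Cauchy, locally uniformly. -/
theorem partialSum_weakCauchy [CompleteSpace H] (h2p : Q.C2Plus) {f : ℕ → ℂ}
    (hf2 : Summable fun n => ‖f n‖ ^ 2) {q : ℕ → ℝ → ℂ} (hq : ∀ j, Continuous (q j)) (a δ : ℝ)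
    (M : ℕ) {ε : ℝ} (hε : 0 < ε) :
    ∃ N₀, ∀ N ≥ N₀, ∀ N' ≥ N₀, ∀ j ≤ M, ∀ x, |x - a| ≤ δ →
      ‖prim a (q j * ((∑ n ∈ Finset.range (N + 1), f n • Q.e n)
        - ∑ n ∈ Finset.range (N' + 1), f n • Q.e n)) x‖ ≤ ε := by
  choose C hC hbound using fun j =>
    exists_norm_prim_le h2p.2.continuous h2p.1 (hq j) a δ
  set K := ∑ j ∈ Finset.range (M + 1), C j
  have hK : 0 ≤ K := Finset.sum_nonneg fun j _ => hC j
  have hmem : Memℓp f 2 := memℓp_gen (by simpa using hf2)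
  have hsum := Q.basis.hasSum_repr_symm ⟨f, hmem⟩
  have htend := ((Q.space.continuous_toFn.tendsto _).comp
    (hsum.tendsto_sum_nat.comp (tendsto_add_atTop_nat 1))).cauchySeq
  obtain ⟨N₀, hN₀⟩ := Metric.cauchySeq_iff.1 htend (ε / (K + 1)) (by positivity)
  refine ⟨N₀, fun N hN N' hN' j hj x hx => ?_⟩
  have hae : ∀ t : Finset ℕ, (Q.space.toFn (∑ n ∈ t, f n • Q.basis n) : ℝ → ℂ)
      =ᵐ[weightMeasure Q.υ] ∑ n ∈ t, f n • Q.e n := by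
    classical
    intro t
    induction t using Finset.induction_on with
    | empty => simpa using Lp.coeFn_zero ℂ 2 (weightMeasure Q.υ)
    | insert i t hi ih =>
      rw [Finset.sum_insert hi, Finset.sum_insert hi, map_add, map_smul]
      filter_upwards [Lp.coeFn_add (f i • Q.space.toFn (Q.basis i))
        (Q.space.toFn (∑ n ∈ t, f n • Q.basis n)),
        Lp.coeFn_smul (f i) (Q.space.toFn (Q.basis i)), ih, Q.basis_eq i] with x hx1 hx2 hx3 hx4
      rw [hx1, Pi.add_apply, hx2, Pi.smul_apply, hx3, hx4, Pi.add_apply, Pi.smul_apply]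
  have h1 := hbound j _ _ ((Lp.coeFn_sub _ _).trans ((hae (Finset.range (N + 1))).sub
    (hae (Finset.range (N' + 1))))) x hx
  have h2 := hN₀ N hN N' hN'
  rw [dist_eq_norm] at h2
  have h3 : C j ≤ K := Finset.single_le_sum (f := C) (fun i _ => hC i)
    (Finset.mem_range.2 (Nat.lt_succ_iff.2 hj))
  refine h1.trans ?_
  calc _ ≤ K * (ε / (K + 1)) := mul_le_mul h3 h2.le (norm_nonneg _) hK
    _ ≤ ε := by
      rw [mul_div_assoc', div_le_iff₀ (by positivity)]
      nlinarith

end Quintuplet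

/-! ### The residual of the partial sums -/

theorem EigenSystem.exists_primIter_bound {υ : ℝ → ℝ} {e : ℕ → ℝ → ℂ} {n₁ n₀ : ℝ → ℂ} {l : ℕ → ℝ}
    {A : ℝ → ℝ} (h : EigenSystem υ e n₁ n₀ l A) {M : ℕ} (he : ∀ n, ContDiff ℝ M (e n))
    (hυ : ContDiff ℝ M υ) (a : ℝ) {δ : ℝ} (hδ : 0 ≤ δ) :
    ∃ (C : ℝ) (m₀ : ℕ) (Q : ℕ → ℝ → ℂ), 0 ≤ C ∧ (∀ m, IsPolyLT a M (Q m)) ∧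
      ∀ m ≥ m₀, ∀ x, |x - a| ≤ δ → ‖(prim a)^[M] (e m) x - Q m x‖ ≤ C * ((m : ℝ) ^ M)⁻¹ := by
  obtain ⟨k, θ, c, K, hθ, hθ0, hcK, hrep⟩ := h.exists_phase he hυ
  obtain ⟨C, hC, hosc⟩ := primIter_oscillatory hθ hθ0 a hδ M le_rfl (he k)
  obtain ⟨r, hr, hgr⟩ := h.growth
  have hK : 0 ≤ K := (norm_nonneg _).trans (hcK 0)
  -- The frequency in the phase is `l m - l k`; half of the growth rate `r` absorbs the fixed `l k`.
  have hlarge : ∀ᶠ m : ℕ in atTop, r / 2 * m ≤ |l m - l k| ∧ 0 < r / 2 * (m : ℝ) := by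
    have htop : Tendsto (fun n : ℕ => r / 2 * (n : ℝ)) atTop atTop :=
      tendsto_natCast_atTop_atTop.const_mul_atTop (by positivity)
    filter_upwards [hgr, htop.eventually_gt_atTop |l k|] with m h1 h2
    have h3 := abs_sub_abs_le_abs_sub (l m) (l k)
    exact ⟨by linarith, (abs_nonneg _).trans_lt h2⟩
  obtain ⟨m₀, hm₀⟩ := eventually_atTop.1 hlarge
  have hQ : ∀ m, ∃ Q, IsPolyLT a M Q ∧ (m ≥ m₀ → ∀ x, |x - a| ≤ δ →
      ‖(prim a)^[M] (e m) x - Q x‖ ≤ K * C * ((r / 2) ^ M)⁻¹ * ((m : ℝ) ^ M)⁻¹) := by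
    intro m
    by_cases hm : m₀ ≤ m
    · obtain ⟨h1, h2⟩ := hm₀ m hm
      have hμ : l m - l k ≠ 0 := abs_pos.1 (h2.trans_le h1)
      obtain ⟨Q, hQ, hb⟩ := hosc (l m - l k) hμ
      refine ⟨c m • Q, hQ.smul _, fun _ x hx => ?_⟩
      have hem : e m = c m • fun t => e k t * Complex.exp (Complex.I * (l m - l k : ℝ) * θ t) :=
        funext fun t => hrep m t
      rw [hem, primIter_smul, Pi.smul_apply, Pi.smul_apply, ← smul_sub, norm_smul]
      have h3 : (|l m - l k| ^ M)⁻¹ ≤ ((r / 2) ^ M)⁻¹ * ((m : ℝ) ^ M)⁻¹ := by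
        rw [← mul_inv, ← mul_pow]
        exact inv_anti₀ (pow_pos h2 M) (pow_le_pow_left₀ h2.le h1 M)
      calc _ ≤ K * (C * (((r / 2) ^ M)⁻¹ * ((m : ℝ) ^ M)⁻¹)) := by
            refine mul_le_mul (hcK m) ((hb x hx).trans ?_) (norm_nonneg _) hK
            exact mul_le_mul_of_nonneg_left h3 hC
        _ = _ := by ring
    · exact ⟨0, IsPolyLT.zero a M, fun h => absurd h hm⟩
  choose Q hQ1 hQ2 using hQ
  exact ⟨_, m₀, Q, by positivity, hQ1, fun m hm => hQ2 m hm⟩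

/-- The coefficients of the image of a partial sum under a band matrix of growth `n^M`: they
vanish below the band edge and are small at the edge. -/
theorem band_coeff {b : ℕ → ℕ → ℂ} {L M : ℕ} {K : ℝ} (hK : 0 ≤ K)
    (hband : ∀ m n : ℕ, m + L < n ∨ n + L < m → b m n = 0)
    (hgr : ∀ m n : ℕ, 1 ≤ n → ‖b m n‖ ≤ K * (n : ℝ) ^ M) {f : ℕ → ℂ}
    (hf : ∀ m, HasSum (fun n => b m n * f n) 0) :
    (∀ N m, m + L ≤ N → ∑ n ∈ Finset.range (N + 1), b m n * f n = 0) ∧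
    ∀ N m ε, 2 * L < N → N < m + L → (∀ n, N ≤ n + 2 * L → ‖f n‖ ≤ ε) →
      ‖∑ n ∈ Finset.range (N + 1), b m n * f n‖ ≤ (2 * L + 1) * (K * (N : ℝ) ^ M * ε) := by
  -- If `m + L ≤ N`, the truncated sum already contains every nonzero term of row `m`.
  refine ⟨fun N m hm => ?_, fun N m ε hN hm hε => ?_⟩
  · refine (hasSum_sum_of_ne_finset_zero fun n hn => ?_ : HasSum _ _).unique (hf m)
    rw [hband m n (Or.inl (by simp at hn; omega)), zero_mul]
  -- If `m > N - L`, a nonzero entry has `n ≥ m - L > N - 2L`, so at most `2L + 1` terms occur. `2L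
  -- < N` ensures `n ≥ 1`, where the growth bound holds.
  · have h1 : ∑ n ∈ Finset.range (N + 1), b m n * f n
        = ∑ n ∈ Finset.Icc (N - 2 * L) N, b m n * f n := by
      symm
      refine Finset.sum_subset (fun n hn => by simp at hn ⊢; omega) fun n _ hn => ?_
      rw [hband m n (Or.inr (by simp at *; omega)), zero_mul]
    rw [h1]
    refine (norm_sum_le _ _).trans
      ((Finset.sum_le_sum (g := fun _ => K * (N : ℝ) ^ M * ε) fun n hn => ?_).trans ?_)
    · rw [Finset.mem_Icc] at hn
      rw [norm_mul]
      refine mul_le_mul ((hgr m n (by omega)).trans ?_) (hε n (by omega)) (norm_nonneg _)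
        (by positivity)
      have : (n : ℝ) ≤ N := by exact_mod_cast hn.2
      gcongr
    · rw [Finset.sum_const, nsmul_eq_mul, Nat.card_Icc]
      have h2 : ((N + 1 - (N - 2 * L) : ℕ) : ℝ) = 2 * L + 1 := by
        rw [show N + 1 - (N - 2 * L) = 2 * L + 1 by omega]
        push_cast
        ring
      rw [h2]

namespace Quintuplet

variable {H : Type*} [NormedAddCommGroup H] [InnerProductSpace ℂ H] {Q : Quintuplet H}

/-- The `M`-fold primitive of the image of a partial sum is close to a polynomial. -/
theorem exists_residual_bound (hM : 1 ≤ Q.M) (hp : ∀ m ≤ Q.M, ContDiff ℝ ∞ (Q.p m))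
    (h1 : Q.C1) (h2 : Q.C2 h1) (h2p : Q.C2Plus) (h21 : Q.C2_1 h1) (h22 : Q.C2_2) (h23 : Q.C2_3)
    {f : ℕ → ℂ} (hfV : f ∈ Q.V h1) (hf0 : Tendsto f atTop (𝓝 0)) (a : ℝ) {δ : ℝ} (hδ : 0 ≤ δ) :
    ∃ R : ℕ → ℝ → ℂ, (∀ N, IsPolyLT a Q.M (R N)) ∧ ∀ ε > 0, ∃ N₀, ∀ N ≥ N₀, ∀ x, |x - a| ≤ δ →
      ‖(prim a)^[Q.M] (shiftedOp Q.M Q.p Q.lam (∑ n ∈ Finset.range (N + 1), f n • Q.e n)) x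
        - R N x‖ ≤ ε := by
  obtain ⟨n₁, n₀, l, A, hE⟩ := Q.exists_eigenSystem hM h2p h22 h23
  obtain ⟨heD, -⟩ := h22
  obtain ⟨C, m₀, P, hC, hP, hbound⟩ := hE.exists_primIter_bound heD h2p.2 a hδ
  obtain ⟨ℓ₀, hℓ₀⟩ := h2
  obtain ⟨K', hK'⟩ := h21
  set L := ℓ₀.toNat
  set K := max K' 0
  have hK : 0 ≤ K := le_max_right _ _
  have hband : ∀ m n : ℕ, m + L < n ∨ n + L < m → Q.b h1 m n = 0 := fun m n hmn =>
    hℓ₀ m n (by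
      have := Int.self_le_toNat ℓ₀
      rcases hmn with h | h
      · exact lt_of_lt_of_le (by omega) (le_abs_self _)
      · exact lt_of_lt_of_le (by omega) (neg_le_abs _))
  have hgr : ∀ m n : ℕ, 1 ≤ n → ‖Q.b h1 m n‖ ≤ K * (n : ℝ) ^ Q.M := fun m n hn => by
    have hn' : (0 : ℝ) < n := by exact_mod_cast hn
    exact ((div_le_iff₀ (pow_pos hn' _)).1 (hK' m n hn)).trans
      (mul_le_mul_of_nonneg_right (le_max_left _ _) (by positivity))
  obtain ⟨hd0, hdle⟩ := band_coeff hK hband hgr hfV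
  set d : ℕ → ℕ → ℂ := fun N m => ∑ n ∈ Finset.range (N + 1), Q.b h1 m n * f n with hd
  have hexp : ∀ N, shiftedOp Q.M Q.p Q.lam (∑ n ∈ Finset.range (N + 1), f n • Q.e n)
      = ∑ m ∈ Finset.range (N + L + 1), d N m • Q.eD m := by
    intro N
    ext x
    rw [(shiftedOp_sum _ f (fun n => (h1 n).1) x).2, Finset.sum_apply]
    simp only [hd, Pi.smul_apply, smul_eq_mul, Finset.sum_mul]
    rw [Finset.sum_comm]
    refine Finset.sum_congr rfl fun n hn => ?_
    rw [shiftedOp_basis hp h1 h2p (fun n => (heD n).continuous) n (Finset.range (N + L + 1))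
      (fun m hm => hband m n (Or.inr (by simp at hn hm; omega))), Finset.mul_sum]
    exact Finset.sum_congr rfl fun m _ => by ring
  refine ⟨fun N => ∑ m ∈ Finset.range (N + L + 1), d N m • P m,
    fun N => IsPolyLT.sum _ fun m _ => (hP m).smul _, fun ε hε => ?_⟩
  -- The first `2L + 1` counts the surviving indices `m`, the second comes from `band_coeff`, and `2
  -- ^ M` from `N ≤ 2m`. The growth `N^M` of the coefficients is exactly cancelled by the decay
  -- `m^{-M}` of the primitives; smallness comes from `f_n → 0` alone.
  set D : ℝ := (2 * L + 1) * ((2 * L + 1) * (K * 2 ^ Q.M) * C) with hD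
  have hD0 : 0 ≤ D := by positivity
  set η := ε / (D + 1) with hη
  have hη0 : 0 < η := by positivity
  have hDη : D * η ≤ ε := by
    rw [hη, mul_div_assoc', div_le_iff₀ (by positivity)]
    nlinarith
  obtain ⟨N₁, hN₁⟩ := Metric.tendsto_atTop.1 hf0 η hη0
  refine ⟨N₁ + m₀ + 2 * L + 1, fun N hN x hx => ?_⟩
  rw [hexp, primIter_sum _ _ fun m _ => (heD m).continuous.const_smul (d N m), Finset.sum_apply]
  dsimp only
  rw [Finset.sum_apply, ← Finset.sum_sub_distrib]
  have hrestrict : ∑ m ∈ Finset.range (N + L + 1),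
      ((prim a)^[Q.M] (d N m • Q.eD m) x - (d N m • P m) x)
      = ∑ m ∈ Finset.Icc (N - L) (N + L),
        d N m * ((prim a)^[Q.M] (Q.eD m) x - P m x) := by
    have e1 : ∀ m, (prim a)^[Q.M] (d N m • Q.eD m) x - (d N m • P m) x
        = d N m * ((prim a)^[Q.M] (Q.eD m) x - P m x) := fun m => by
      rw [primIter_smul, Pi.smul_apply, Pi.smul_apply, smul_eq_mul, smul_eq_mul, mul_sub]
    simp only [e1]
    symm
    refine Finset.sum_subset (fun m hm => by simp at hm ⊢; omega) fun m hm hm' => ?_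
    have : d N m = 0 := hd0 N m (by simp at hm hm'; omega)
    rw [this, zero_mul]
  rw [hrestrict]
  have hterm : ∀ m ∈ Finset.Icc (N - L) (N + L),
      ‖d N m * ((prim a)^[Q.M] (Q.eD m) x - P m x)‖
        ≤ (2 * L + 1) * (K * 2 ^ Q.M) * C * η := by
    intro m hm
    rw [Finset.mem_Icc] at hm
    have hm0 : (0 : ℝ) < m := by exact_mod_cast (by omega : 0 < m)
    have hdN : ‖d N m‖ ≤ (2 * L + 1) * (K * (N : ℝ) ^ Q.M * η) := by
      rcases Nat.lt_or_ge N (m + L) with h | h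
      · refine hdle N m η (by omega) h fun n hn => ?_
        have := hN₁ n (by omega)
        rw [dist_zero_right] at this
        exact this.le
      · have : d N m = 0 := hd0 N m h
        rw [this, norm_zero]
        positivity
    have hNm : (N : ℝ) ^ Q.M ≤ 2 ^ Q.M * (m : ℝ) ^ Q.M := by
      rw [← mul_pow]
      refine pow_le_pow_left₀ (by positivity) ?_ _
      exact_mod_cast (by omega : N ≤ 2 * m)
    rw [norm_mul]
    calc _ ≤ ((2 * L + 1) * (K * (2 ^ Q.M * (m : ℝ) ^ Q.M) * η)) * (C * ((m : ℝ) ^ Q.M)⁻¹) := by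
          refine mul_le_mul (hdN.trans ?_) (hbound m (by omega) x hx) (norm_nonneg _)
            (by positivity)
          gcongr
      _ = _ := by field_simp
  refine (norm_sum_le_of_le _ hterm).trans ?_
  rw [Finset.sum_const, nsmul_eq_mul, Nat.card_Icc]
  have hcard : ((N + L + 1 - (N - L) : ℕ) : ℝ) = 2 * L + 1 := by
    rw [show N + L + 1 - (N - L) = 2 * L + 1 by omega]
    push_cast
    ring
  rw [hcard]
  refine le_trans (le_of_eq ?_) hDη
  rw [hD]
  ring

/-! ### Local solutions and gluing -/

/-- Near a point where the leading coefficient does not vanish, the expansion converges to a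
solution. -/
theorem exists_local_solution [CompleteSpace H] (hM : 1 ≤ Q.M)
    (hp : ∀ m ≤ Q.M, ContDiff ℝ ∞ (Q.p m)) (h1 : Q.C1) (h2 : Q.C2 h1) (h2p : Q.C2Plus)
    (h21 : Q.C2_1 h1) (h22 : Q.C2_2) (h23 : Q.C2_3) {f : ℕ → ℂ} (hfV : f ∈ Q.V h1)
    (hf2 : Summable fun n => ‖f n‖ ^ 2) {a : ℝ} (ha : Q.p Q.M a ≠ 0) :
    ∃ (φ : ℝ → ℂ) (δ : ℝ), 0 < δ ∧ ContDiffAt ℝ Q.M φ a ∧ shiftedOp Q.M Q.p Q.lam φ a = 0 ∧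
      ∀ x, |x - a| ≤ δ →
        Tendsto (fun N : ℕ => ∑ n ∈ Finset.range (N + 1), f n * Q.e n x) atTop (𝓝 (φ x)) := by
  obtain ⟨q, hq, hqM, hqdiv⟩ := exists_divergence_form hM hp Q.lam
  obtain ⟨ε, hε, hball⟩ := Metric.eventually_nhds_iff.1
    ((hp Q.M le_rfl).continuous.continuousAt.eventually_ne ha)
  set δ := ε / 2 with hδdef
  have hδ : 0 < δ := by positivity
  have hqM' : ∀ x, |x - a| ≤ δ → q Q.M x ≠ 0 := fun x hx => by
    rw [hqM]
    exact hball (by rw [Real.dist_eq]; linarith)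
  have hf0 : Tendsto f atTop (𝓝 0) := by
    rw [tendsto_zero_iff_norm_tendsto_zero]
    have h := (Real.continuous_sqrt.tendsto 0).comp hf2.tendsto_atTop_zero
    simpa [Function.comp_def, Real.sqrt_sq] using h
  obtain ⟨R, hR, hRb⟩ := exists_residual_bound hM hp h1 h2 h2p h21 h22 h23 hfV hf0 a hδ.le
  set u : ℕ → ℝ → ℂ := fun N => ∑ n ∈ Finset.range (N + 1), f n • Q.e n with hu
  have huM : ∀ N, ContDiff ℝ Q.M (u N) := fun N =>
    (shiftedOp_sum (p := Q.p) (lam := Q.lam) _ f (fun n => (h1 n).1) 0).1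
  -- Chosen so that `divInt` of `u N` minus this polynomial equals the `M`-fold primitive of `P u_N`
  -- minus `R N`, which is small.
  have hpoly : ∀ N, IsPolyLT a Q.M (R N
      - ((prim a)^[Q.M] (shiftedOp Q.M Q.p Q.lam (u N)) - divInt Q.M q a (u N))) := fun N =>
    (hR N).sub (primIter_divergence hq a (huM N) fun x => hqdiv _ x (huM N).contDiffAt)
  choose v hv using hpoly
  obtain ⟨φ, w, hφ, hlim, heq⟩ := exists_limit_solution (fun j => (hq j).continuous) a hδ hqM' u
    (fun N => (huM N).continuous) v (fun ε' hε' => by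
      obtain ⟨N₀, hN₀⟩ := hRb ε' hε'
      refine ⟨N₀, fun N hN x hx => ?_⟩
      rw [← hv N]
      refine le_trans (le_of_eq ?_) (hN₀ N hN x hx)
      simp only [Pi.sub_apply]
      congr 1
      ring) fun ε' hε' =>
      partialSum_weakCauchy h2p hf2 (fun j => (hq j).continuous) a δ Q.M hε'
  obtain ⟨hφM, hsol⟩ := contDiffOn_and_solution hq a hqM' hφ heq
  have hφa : ContDiffAt ℝ Q.M φ a := hφM.contDiffAt (Metric.ball_mem_nhds a hδ)
  refine ⟨φ, δ, hδ, hφa, ?_, fun x hx => ?_⟩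
  · rw [hqdiv φ a hφa]
    exact hsol a (Metric.mem_ball_self hδ)
  · simpa [hu] using hlim x hx

end Quintuplet

end

end BandODE

theorem mainTheorem5 {H : Type*} [NormedAddCommGroup H] [InnerProductSpace ℂ H] [CompleteSpace H]
    (Q : BandODE.Quintuplet H) (hM : 1 ≤ Q.M) (hp : ∀ m ≤ Q.M, ContDiff ℝ ∞ (Q.p m))
    (h1 : Q.C1) (h2 : Q.C2 h1) (h2p : Q.C2Plus) (h21 : Q.C2_1 h1) (h22 : Q.C2_2) (h23 : Q.C2_3)
    (f : ℕ → ℂ) (hfV : f ∈ Q.V h1) (hf2 : Summable fun n => ‖f n‖ ^ 2) :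
    ∃ φ : ℝ → ℂ, ContDiffOn ℝ Q.M φ {x | Q.p Q.M x ≠ 0} ∧
      ∀ x, Q.p Q.M x ≠ 0 →
        BandODE.shiftedOp Q.M Q.p Q.lam φ x = 0 ∧
        Tendsto (fun N : ℕ => ∑ n ∈ Finset.range (N + 1), f n * Q.e n x) atTop (𝓝 (φ x)) := by
  have hloc := fun (a : ℝ) (ha : Q.p Q.M a ≠ 0) =>
    BandODE.Quintuplet.exists_local_solution hM hp h1 h2 h2p h21 h22 h23 hfV hf2 ha
  choose! ψ δ hδ hψM hψ0 hψlim using hloc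
  -- Local solutions are pointwise limits of the same partial sums, so they agree where they
  -- overlap, and the diagonal `ψ x x` glues them.
  have hnear : ∀ a, Q.p Q.M a ≠ 0 → (fun x => ψ x x) =ᶠ[𝓝 a] ψ a := by
    intro a ha
    filter_upwards [(hp Q.M le_rfl).continuous.continuousAt.eventually_ne ha,
      Metric.ball_mem_nhds a (hδ a ha)] with x hx hx'
    rw [Metric.mem_ball, Real.dist_eq] at hx'
    exact tendsto_nhds_unique (hψlim x hx x (by simpa using (hδ x hx).le)) (hψlim a ha x hx'.le)
  refine ⟨fun x => ψ x x, fun a ha => ((hψM a ha).congr_of_eventuallyEq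
    (hnear a ha)).contDiffWithinAt, fun a ha => ⟨?_, hψlim a ha a (by simpa using (hδ a ha).le)⟩⟩
  rw [← hψ0 a ha]
  simp only [BandODE.shiftedOp, BandODE.diffOp]
  congr 1
  exact Finset.sum_congr rfl fun m _ => by rw [(hnear a ha).iteratedDeriv_eq m]
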